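/- **Theorem (Maximal ambiguity).** Fix $\hbar>0$. An *ideal (continuous-time) Page–Wootters system* consists of - an ideal clock: a complex Hilbert space $\mathcal H_c$ with a unitary identification $\mathcal H_c\cong L^2(\mathbb R)$ (the time representation), in which the clock Hamiltonian is $H_c=-i\hbar\,\partial_\tau$ (weak derivative, domain the Sobolev space $H^1(\mathbb R)$), and - a world: a complex Hilbert space $\mathcal H_r$ with a self-adjoint, possibly unbounded, Hamiltonian $H_r$, with noninteracting total Hamiltonian $H=H_c\otimes I_r+I_c\otimes H_r$ on the Hilbert space tensor product $\mathcal H=\mathcal H_c\otimes\mathcal H_r$ (the closure of this operator from the algebraic tensor product of the domains of $H_c$ and $H_r$). Let $\Phi\subset\mathcal H$ be the space of vectors that correspond to continuous compactly supported functions $F:\mathbb R\to\mathcal H_r$ under $\mathcal H\cong L^2(\mathbb R;\mathcal H_r)$. For $\tau\in\mathbb R$ and $\psi\in\mathcal H_r$, the generalized vector $|\tau\rangle_c|\psi\rangle_r$ is the antilinear functional $F\mapsto\langle F(\tau),\psi\rangle$ on $\Phi$. The *temporal states* with initial state $|\Psi(0)\rangle=|0\rangle_c|\psi(0)\rangle_r$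 are $$|\Psi(\tau)\rangle=|\tau\rangle_c\,|\psi(\tau)\rangle_r,\qquad |\psi(\tau)\rangle_r=e^{-\frac{i}{\hbar}H_r\tau}|\psi(0)\rangle_r,\qquad \tau\in\mathbb R .$$ Let $(\mathcal H_c,\mathcal H_r,H_r)$ and $(\mathcal H_{c'},\mathcal H_{r'},H_{r'})$ be two ideal Page–Wootters systems with $\dim\mathcal H_r=\dim\mathcal H_{r'}$ (Hilbert space dimension), with total Hamiltonians $H$, $H'$ and spaces $\Phi$, $\Phi'$. Then for all $\psi(0)\in\mathcal H_r$ and $\psi'(0)\in\mathcal H_{r'}$ of equal norm (in particular for all unit vectors) there is a unitary operator $S:\mathcal H_c\otimes\mathcal H_r\to\mathcal H_{c'}\otimes\mathcal H_{r'}$ such that $$H'=S\,H\,S^{-1}$$ (with equality of domains), $S\Phi=\Phi'$, and $$|\Psi'(\tau)\rangle=S\,|\Psi(\tau)\rangle\qquad\text{for all }\tau\in\mathbb R,$$ where $S$ acts on antilinear functionals $\eta$ on $\Phi$ by $(S\eta)(y)=\eta(S^{-1}y)$ for $y\in\Phi'$. -/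

import Mathlib

open MeasureTheory
open scoped TensorProduct ContDiff ComplexConjugate

universe u v u' v'

noncomputable section

namespace PageWootters

/-- The Hilbert space `L²(ℝ; ℂ)` with respect to Lebesgue measure. -/
abbrev L2R : Type := Lp ℂ 2 (volume : Measure ℝ)

/-! ### Unbounded operators -/

section Operators

variable {E : Type u} {F : Type v}
  [NormedAddCommGroup E] [InnerProductSpace ℂ E]
  [NormedAddCommGroup F] [InnerProductSpace ℂ F]

/-- For a unitary `S : E → F` and a partially defined operator `A` on `E`, the operator
`S A S⁻¹` on `F`, with domain `S (dom A)`. -/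
def unitaryConj (S : E ≃ₗᵢ[ℂ] F) (A : E →ₗ.[ℂ] E) : F →ₗ.[ℂ] F where
  domain := A.domain.comap (S.symm.toLinearEquiv : F →ₗ[ℂ] E)
  toFun := (S.toLinearEquiv : E →ₗ[ℂ] F) ∘ₗ A.toFun ∘ₗ
    (S.symm.toLinearEquiv : F →ₗ[ℂ] E).restrict (fun _ hy => hy)

/-- `U` is a strongly continuous one-parameter unitary group whose generator is `A`, in the sense
that `U τ = exp (-(i/ħ) A τ)`: a vector `x` lies in the domain of `A`, with `A x = y`, exactly when
`τ ↦ U τ x` is differentiable at `0` with derivative `-(i/ħ) y`. -/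
structure IsEvolutionGroup (ħ : ℝ) (A : E →ₗ.[ℂ] E) (U : ℝ → (E ≃ₗᵢ[ℂ] E)) : Prop where
  add : ∀ (s t : ℝ) (x : E), U (s + t) x = U s (U t x)
  continuous : ∀ x : E, Continuous fun t => U t x
  generator : ∀ x y : E, (x, y) ∈ A.graph ↔
    HasDerivAt (fun t => U t x) (-(Complex.I / (ħ : ℂ)) • y) 0

open scoped Classical in
/-- The unitary evolution `τ ↦ exp (-(i/ħ) A τ)` generated by a self-adjoint operator `A`, i.e. the
strongly continuous unitary group with generator `A`; for a self-adjoint operator it exists and is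
unique. (For an operator that generates no such group the value is the identity.) -/
def evolution (ħ : ℝ) (A : E →ₗ.[ℂ] E) : ℝ → (E ≃ₗᵢ[ℂ] E) :=
  if h : ∃ U : ℝ → (E ≃ₗᵢ[ℂ] E), IsEvolutionGroup ħ A U then h.choose
  else fun _ => LinearIsometryEquiv.refl ℂ E

/-- The Hilbert space dimension: the cardinality of an orthonormal Hilbert basis. -/
def hilbertDim (E : Type u) [NormedAddCommGroup E] [InnerProductSpace ℂ E] : Cardinal.{u} :=
  sInf {c | ∃ ι : Type u, Nonempty (HilbertBasis ι ℂ E) ∧ Cardinal.mk ι = c}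

end Operators

/-! ### The operator `∂_τ` on `L²(ℝ)` -/

/-- `g` is the weak derivative of `f` on the real line. -/
def HasWeakDeriv (f g : ℝ → ℂ) : Prop :=
  ∀ φ : ℝ → ℝ, ContDiff ℝ ∞ φ → HasCompactSupport φ →
    ∫ t, deriv φ t • f t = - ∫ t, φ t • g t

lemma integrable_test_smul {φ : ℝ → ℝ} (hφ : Continuous φ) (hc : HasCompactSupport φ)
    (f : L2R) : Integrable (fun t => φ t • f t) volume := by
  have hf : LocallyIntegrable (f : ℝ → ℂ) volume :=
    (Lp.memLp f).locallyIntegrable (by norm_num)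
  exact hf.integrable_smul_left_of_hasCompactSupport hφ hc

/-- The graph of `∂_τ` on `L²(ℝ)`: the pairs `(f, g)` of elements of `L²(ℝ)` such that `g` is the
weak derivative of `f`. -/
def weakDerivGraph : Submodule ℂ (L2R × L2R) where
  carrier := {p | HasWeakDeriv p.1 p.2}
  zero_mem' := by
    intro φ _ _
    have h : ∀ᵐ t : ℝ, ((0 : L2R) : ℝ → ℂ) t = 0 := Lp.coeFn_zero ℂ 2 volume
    have h1 : ∫ t, deriv φ t • ((0 : L2R) : ℝ → ℂ) t = 0 :=
      integral_eq_zero_of_ae (by filter_upwards [h] with t ht; rw [ht]; simp)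
    have h2 : ∫ t, φ t • ((0 : L2R) : ℝ → ℂ) t = 0 :=
      integral_eq_zero_of_ae (by filter_upwards [h] with t ht; rw [ht]; simp)
    simp only [Prod.fst_zero, Prod.snd_zero]
    rw [h1, h2, neg_zero]
  add_mem' := by
    intro p q hp hq φ hφ hc
    have hd : Continuous (deriv φ) := hφ.continuous_deriv (by simp)
    have h1 : ∫ t, deriv φ t • ((p.1 + q.1 : L2R) : ℝ → ℂ) t
        = (∫ t, deriv φ t • p.1 t) + ∫ t, deriv φ t • q.1 t := by
      rw [← integral_add (integrable_test_smul hd hc.deriv _) (integrable_test_smul hd hc.deriv _)]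
      refine integral_congr_ae ?_
      filter_upwards [Lp.coeFn_add p.1 q.1] with t ht
      rw [ht, Pi.add_apply, smul_add]
    have h2 : ∫ t, φ t • ((p.2 + q.2 : L2R) : ℝ → ℂ) t
        = (∫ t, φ t • p.2 t) + ∫ t, φ t • q.2 t := by
      rw [← integral_add (integrable_test_smul hφ.continuous hc _)
        (integrable_test_smul hφ.continuous hc _)]
      refine integral_congr_ae ?_
      filter_upwards [Lp.coeFn_add p.2 q.2] with t ht
      rw [ht, Pi.add_apply, smul_add]
    simp only [Prod.fst_add, Prod.snd_add]
    rw [h1, h2, hp φ hφ hc, hq φ hφ hc, neg_add]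
  smul_mem' := by
    intro c p hp φ hφ hc
    have h1 : ∫ t, deriv φ t • ((c • p.1 : L2R) : ℝ → ℂ) t = c • ∫ t, deriv φ t • p.1 t := by
      rw [← integral_smul]
      refine integral_congr_ae ?_
      filter_upwards [Lp.coeFn_smul c p.1] with t ht
      simp only [ht, Pi.smul_apply]
      rw [smul_comm]
    have h2 : ∫ t, φ t • ((c • p.2 : L2R) : ℝ → ℂ) t = c • ∫ t, φ t • p.2 t := by
      rw [← integral_smul]
      refine integral_congr_ae ?_
      filter_upwards [Lp.coeFn_smul c p.2] with t ht
      simp only [ht, Pi.smul_apply]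
      rw [smul_comm]
    simp only [Prod.smul_fst, Prod.smul_snd]
    rw [h1, h2, hp φ hφ hc, smul_neg]

/-- Weak derivatives are unique, so `weakDerivGraph` is the graph of an operator. -/
lemma weakDerivGraph_single_valued (p : L2R × L2R) (hp : p ∈ weakDerivGraph) (h0 : p.1 = 0) :
    p.2 = 0 := by
  have hli : LocallyIntegrable (p.2 : ℝ → ℂ) volume :=
    (Lp.memLp p.2).locallyIntegrable (by norm_num)
  have key := ae_eq_zero_of_integral_contDiff_smul_eq_zero hli (fun φ hφ hc => by
    have h := hp φ hφ hc
    have hz : ∀ᵐ t : ℝ, (p.1 : ℝ → ℂ) t = 0 := by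
      rw [h0]; exact Lp.coeFn_zero ℂ 2 volume
    have h1 : ∫ t, deriv φ t • p.1 t = 0 :=
      integral_eq_zero_of_ae (by filter_upwards [hz] with t ht; simp [ht])
    rw [h1] at h
    exact neg_eq_zero.mp h.symm)
  exact (Lp.eq_zero_iff_ae_eq_zero).2 key

/-- The operator `∂_τ` on `L²(ℝ)`, with domain the Sobolev space `H¹(ℝ)`. -/
def timeDeriv : L2R →ₗ.[ℂ] L2R := weakDerivGraph.toLinearPMap

/-- On test functions, `-iħ ∂_τ` has a formal adjoint (integration by parts). -/
lemma timeDeriv_formal_adjoint (ħ : ℝ) (g : L2R)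
    (hg : ∃ φ : ℝ → ℂ, g =ᵐ[volume] φ ∧ HasCompactSupport φ ∧ ContDiff ℝ ∞ φ) :
    ∃ h : L2R, ∀ x : timeDeriv.domain,
      (inner ℂ ((-(Complex.I * (ħ : ℂ))) • timeDeriv x) g : ℂ) = inner ℂ (x : L2R) h := by
  obtain ⟨φ, hgφ, hc, hφ⟩ := hg
  have hd : Continuous (deriv φ) := hφ.continuous_deriv (by simp)
  have hdm : MemLp (deriv φ) 2 (volume : Measure ℝ) := hd.memLp_of_hasCompactSupport hc.deriv
  refine ⟨(-(Complex.I * (ħ : ℂ))) • hdm.toLp, fun x => ?_⟩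
  obtain ⟨f, hf⟩ := x
  set y : L2R := timeDeriv ⟨f, hf⟩ with hy
  have hmem : (f, y) ∈ weakDerivGraph := by
    rw [← Submodule.toLinearPMap_graph_eq weakDerivGraph weakDerivGraph_single_valued]
    exact LinearPMap.mem_graph _ ⟨f, hf⟩
  have hre : ContDiff ℝ ∞ fun t => (φ t).re := Complex.reCLM.contDiff.comp hφ
  have him : ContDiff ℝ ∞ fun t => (φ t).im := Complex.imCLM.contDiff.comp hφ
  have hrc : HasCompactSupport fun t => (φ t).re := hc.comp_left (g := Complex.re) rfl
  have hic : HasCompactSupport fun t => (φ t).im := hc.comp_left (g := Complex.im) rfl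
  have hdiff : ∀ t, HasDerivAt φ (deriv φ t) t := fun t =>
    ((hφ.differentiable (by simp)) t).hasDerivAt
  have hdre : ∀ t, deriv (fun t => (φ t).re) t = (deriv φ t).re := fun t =>
    (Complex.reCLM.hasFDerivAt.comp_hasDerivAt t (hdiff t)).deriv
  have hdim : ∀ t, deriv (fun t => (φ t).im) t = (deriv φ t).im := fun t =>
    (Complex.imCLM.hasFDerivAt.comp_hasDerivAt t (hdiff t)).deriv
  have e1 := hmem _ hre hrc
  have e2 := hmem _ him hic
  have split : ∀ (θ : ℝ → ℂ), Continuous θ → HasCompactSupport θ → ∀ k : L2R,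
      (∫ t, (k : ℝ → ℂ) t * conj (θ t))
        = (∫ t, (θ t).re • (k : ℝ → ℂ) t) - Complex.I * ∫ t, (θ t).im • (k : ℝ → ℂ) t := by
    intro θ hθ hθc k
    have i1 := integrable_test_smul (Complex.continuous_re.comp hθ)
      (hθc.comp_left (g := Complex.re) rfl) k
    have i2 := integrable_test_smul (Complex.continuous_im.comp hθ)
      (hθc.comp_left (g := Complex.im) rfl) k
    simp only [Function.comp] at i1 i2
    rw [← integral_const_mul, ← integral_sub i1 (i2.const_mul _)]
    refine integral_congr_ae (Filter.Eventually.of_forall fun t => ?_)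
    have : conj (θ t) = ((θ t).re : ℂ) - Complex.I * ((θ t).im : ℂ) := by
      apply Complex.ext <;> simp
    simp only [this, Complex.real_smul]
    ring
  have main : (∫ t, (y : ℝ → ℂ) t * conj (φ t)) = -∫ t, (f : ℝ → ℂ) t * conj (deriv φ t) := by
    rw [split φ hφ.continuous hc y, split (deriv φ) hd hc.deriv f]
    simp only [hdre] at e1
    simp only [hdim] at e2
    rw [e1, e2]
    ring
  have g1 : (inner ℂ g y : ℂ) = ∫ t, (y : ℝ → ℂ) t * conj (φ t) := by
    rw [L2.inner_def]
    refine integral_congr_ae ?_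
    filter_upwards [hgφ] with t ht
    rw [ht]; simp
  have g2 : (inner ℂ (hdm.toLp) f : ℂ) = ∫ t, (f : ℝ → ℂ) t * conj (deriv φ t) := by
    rw [L2.inner_def]
    refine integral_congr_ae ?_
    filter_upwards [hdm.coeFn_toLp] with t ht
    rw [ht]; simp
  have g3 : (inner ℂ y g : ℂ) = -inner ℂ f (hdm.toLp) := by
    rw [← inner_conj_symm, g1, main, ← g2, map_neg, inner_conj_symm]
  rw [inner_smul_left, inner_smul_right, g3]
  simp

/-! ### Tensor products of Hilbert spaces -/

section Tensor

variable {K : Type u} {E : Type v}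
  [NormedAddCommGroup K] [InnerProductSpace ℂ K]
  [NormedAddCommGroup E] [InnerProductSpace ℂ E]

/-- The Hilbert space tensor product `K ⊗ E`: the completion of the algebraic tensor product with
respect to the inner product `⟪x ⊗ y, x' ⊗ y'⟫ = ⟪x, x'⟫ ⟪y, y'⟫`. -/
abbrev HilbertTensor (K : Type u) (E : Type v)
    [NormedAddCommGroup K] [InnerProductSpace ℂ K]
    [NormedAddCommGroup E] [InnerProductSpace ℂ E] : Type (max u v) :=
  UniformSpace.Completion (K ⊗[ℂ] E)

/-- The elementary tensor `x ⊗ y`. -/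
def pureTensor (x : K) (y : E) : HilbertTensor K E :=
  ((x ⊗ₜ[ℂ] y : K ⊗[ℂ] E) : UniformSpace.Completion (K ⊗[ℂ] E))

/-- The graph of `A ⊗ I + I ⊗ B`: the closure of the linear span of all pairs
`(x ⊗ y, A x ⊗ y + x ⊗ B y)` with `x` in the domain of `A` and `y` in the domain of `B`. -/
def tensorSumGraph (A : K →ₗ.[ℂ] K) (B : E →ₗ.[ℂ] E) :
    Submodule ℂ (HilbertTensor K E × HilbertTensor K E) :=
  (Submodule.span ℂ (Set.range fun p : A.domain × B.domain =>
    (pureTensor (p.1 : K) (p.2 : E), pureTensor (A p.1) (p.2 : E) + pureTensor (p.1 : K) (B p.2))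
    )).topologicalClosure

/-- The operator `A ⊗ I + I ⊗ B` on the Hilbert space tensor product `K ⊗ E`: the closure of the
operator with this action on the algebraic tensor product of the domains of `A` and `B`. -/
def tensorSum (A : K →ₗ.[ℂ] K) (B : E →ₗ.[ℂ] E) :
    HilbertTensor K E →ₗ.[ℂ] HilbertTensor K E :=
  (tensorSumGraph A B).toLinearPMap

/-- If `A` and `B` have densely defined formal adjoints `A₀`, `B₀` (for instance if they are
symmetric and densely defined), then `tensorSumGraph A B` is the graph of an operator. -/
lemma tensorSumGraph_single_valued {A : K →ₗ.[ℂ] K} {B : E →ₗ.[ℂ] E} {s : Set K} {t : Set E}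
    (hs : Dense s) (ht : Dense t) {A₀ : K → K} {B₀ : E → E}
    (hA : ∀ (x : A.domain), ∀ u ∈ s, inner ℂ (A x) u = inner ℂ (x : K) (A₀ u))
    (hB : ∀ (y : B.domain), ∀ v ∈ t, inner ℂ (B y) v = inner ℂ (y : E) (B₀ v))
    (p : HilbertTensor K E × HilbertTensor K E) (hp : p ∈ tensorSumGraph A B) (h0 : p.1 = 0) :
    p.2 = 0 := by
  have key : ∀ u ∈ s, ∀ v ∈ t, ∀ q ∈ tensorSumGraph A B,
      (inner ℂ q.2 (pureTensor u v) : ℂ)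
        = inner ℂ q.1 (pureTensor (A₀ u) v + pureTensor u (B₀ v)) := by
    intro u hu v hv q hq
    have hclosed : IsClosed {q : HilbertTensor K E × HilbertTensor K E |
        (inner ℂ q.2 (pureTensor u v) : ℂ)
          = inner ℂ q.1 (pureTensor (A₀ u) v + pureTensor u (B₀ v))} :=
      isClosed_eq (by fun_prop) (by fun_prop)
    refine closure_minimal (fun r hr => ?_) hclosed hq
    induction hr using Submodule.span_induction with
    | mem r hr =>
      obtain ⟨⟨x, y⟩, rfl⟩ := hr
      simp only [Set.mem_ofPred_eq, pureTensor, inner_add_left, inner_add_right,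
        UniformSpace.Completion.inner_coe, TensorProduct.inner_tmul, hA x u hu, hB y v hv]
    | zero => simp
    | add a b _ _ ha hb =>
      simp only [Set.mem_ofPred_eq] at ha hb ⊢
      rw [Prod.snd_add, Prod.fst_add, inner_add_left, inner_add_left, ha, hb]
    | smul c a _ ha =>
      simp only [Set.mem_ofPred_eq] at ha ⊢
      rw [Prod.smul_snd, Prod.smul_fst, inner_smul_left, inner_smul_left, ha]
  have hcont : Continuous fun w : K × E => pureTensor w.1 w.2 :=
    (UniformSpace.Completion.continuous_coe _).comp TensorProduct.continuous_tmul
  have h1 : ∀ w : K × E, (inner ℂ p.2 (pureTensor w.1 w.2) : ℂ) = 0 := by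
    intro w
    have hclosed : IsClosed {w : K × E | (inner ℂ p.2 (pureTensor w.1 w.2) : ℂ) = 0} :=
      isClosed_eq (by fun_prop) continuous_const
    refine closure_minimal (fun w hw => ?_) hclosed ((hs.prod ht) w)
    rw [Set.mem_ofPred_eq, key w.1 hw.1 w.2 hw.2 p hp, h0, inner_zero_left]
  have h2 : ∀ z : HilbertTensor K E, (inner ℂ p.2 z : ℂ) = 0 := by
    intro z
    refine UniformSpace.Completion.induction_on z (isClosed_eq (by fun_prop) continuous_const)
      fun a => ?_
    induction a using TensorProduct.induction_on with
    | zero => rw [UniformSpace.Completion.coe_zero, inner_zero_right]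
    | tmul x y => exact h1 (x, y)
    | add a b ha hb => rw [UniformSpace.Completion.coe_add, inner_add_right, ha, hb, add_zero]
  exact inner_self_eq_zero.1 (h2 p.2)

end Tensor

/-! ### Page-Wootters systems -/

lemma integrable_wave {E : Type v} [NormedAddCommGroup E] [InnerProductSpace ℂ E]
    (f : L2R) (χ : E) {F : ℝ → E} (hF : Continuous F)
    (hc : HasCompactSupport F) :
    Integrable (fun t => conj ((f : ℝ → ℂ) t) * inner ℂ χ (F t)) volume := by
  have hcont : Continuous fun t => (inner ℂ χ (F t) : ℂ) := by fun_prop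
  have hcs : HasCompactSupport fun t => (inner ℂ χ (F t) : ℂ) :=
    hc.comp_left (g := fun y => (inner ℂ χ y : ℂ)) (inner_zero_right χ)
  have h2 : MemLp (fun t => (inner ℂ χ (F t) : ℂ)) 2 volume :=
    hcont.memLp_of_hasCompactSupport hcs
  exact (Lp.memLp f).star.integrable_mul h2

/-- A (continuous-time, ideal) Page-Wootters system. The ideal clock is a Hilbert space `K` with
a time representation `K ≅ L²(ℝ)`; the rest of the world is a Hilbert space `E` with a self-adjoint,
possibly unbounded, Hamiltonian. The total Hamiltonian is defined from these below. -/
structure PWSystem (K : Type u) (E : Type v)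
    [NormedAddCommGroup K] [InnerProductSpace ℂ K]
    [NormedAddCommGroup E] [InnerProductSpace ℂ E] [CompleteSpace E] where
  timeRep : K ≃ₗᵢ[ℂ] L2R
  worldHamiltonian : E →ₗ.[ℂ] E
  selfAdjoint : IsSelfAdjoint worldHamiltonian

namespace PWSystem

variable {K : Type u} {E : Type v}
  [NormedAddCommGroup K] [InnerProductSpace ℂ K]
  [NormedAddCommGroup E] [InnerProductSpace ℂ E] [CompleteSpace E]

/-- The clock Hamiltonian: `-iħ ∂_τ` in the time representation. -/
def clockHamiltonian (P : PWSystem K E) (ħ : ℝ) : K →ₗ.[ℂ] K :=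
  unitaryConj P.timeRep.symm ((-(Complex.I * (ħ : ℂ))) • timeDeriv)

/-- The total Hamiltonian `H = H_c ⊗ I + I ⊗ H_r`. -/
def hamiltonian (P : PWSystem K E) (ħ : ℝ) : HilbertTensor K E →ₗ.[ℂ] HilbertTensor K E :=
  tensorSum (P.clockHamiltonian ħ) P.worldHamiltonian

/-- `F : ℝ → E` is the wave function of `x ∈ K ⊗ E` in the time representation of the clock,
i.e. it corresponds to `x` under `K ⊗ E ≅ L²(ℝ) ⊗ E ≅ L²(ℝ; E)`. -/
def IsWaveFunction (P : PWSystem K E) (x : HilbertTensor K E) (F : ℝ → E) : Prop :=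
  ∀ (f : K) (χ : E),
    inner ℂ (pureTensor f χ) x = ∫ t, conj ((P.timeRep f : ℝ → ℂ) t) * inner ℂ χ (F t)

/-- The test space of the rigged Hilbert space: the vectors of `K ⊗ E` whose wave function is
continuous with compact support. -/
def testSpace (P : PWSystem K E) : Submodule ℂ (HilbertTensor K E) where
  carrier := {x | ∃ F : ℝ → E, Continuous F ∧ HasCompactSupport F ∧ P.IsWaveFunction x F}
  zero_mem' := ⟨0, continuous_zero, HasCompactSupport.zero, fun f χ => by simp⟩
  add_mem' := by
    rintro x y ⟨F, hF, hFc, hx⟩ ⟨G, hG, hGc, hy⟩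
    refine ⟨F + G, hF.add hG, hFc.add hGc, fun f χ => ?_⟩
    rw [inner_add_right, hx, hy,
      ← integral_add (integrable_wave _ _ hF hFc) (integrable_wave _ _ hG hGc)]
    simp [mul_add]
  smul_mem' := by
    rintro c x ⟨F, hF, hFc, hx⟩
    refine ⟨c • F, hF.const_smul c, hFc.smul_left (f := fun _ => c), fun f χ => ?_⟩
    rw [inner_smul_right, hx, ← integral_const_mul]
    refine integral_congr_ae (Filter.Eventually.of_forall fun t => ?_)
    simp only [Pi.smul_apply, inner_smul_right]
    ring

/-- The wave function of a vector of the test space. -/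
def waveFunction (P : PWSystem K E) (x : P.testSpace) : ℝ → E := x.2.choose

lemma continuous_waveFunction (P : PWSystem K E) (x : P.testSpace) :
    Continuous (P.waveFunction x) := x.2.choose_spec.1

lemma hasCompactSupport_waveFunction (P : PWSystem K E) (x : P.testSpace) :
    HasCompactSupport (P.waveFunction x) := x.2.choose_spec.2.1

lemma isWaveFunction_waveFunction (P : PWSystem K E) (x : P.testSpace) :
    P.IsWaveFunction x (P.waveFunction x) := x.2.choose_spec.2.2

/-- A continuous compactly supported wave function is determined by the vector. -/
lemma IsWaveFunction.unique {P : PWSystem K E} {x : HilbertTensor K E} {F G : ℝ → E}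
    (hF : Continuous F) (hFc : HasCompactSupport F) (hxF : P.IsWaveFunction x F)
    (hG : Continuous G) (hGc : HasCompactSupport G) (hxG : P.IsWaveFunction x G) : F = G := by
  funext t
  refine ext_inner_left ℂ fun χ => ?_
  have hcont : ∀ {F : ℝ → E}, Continuous F → Continuous fun t => (inner ℂ χ (F t) : ℂ) :=
    fun h => by fun_prop
  have hmem : ∀ {F : ℝ → E}, Continuous F → HasCompactSupport F →
      MemLp (fun t => (inner ℂ χ (F t) : ℂ)) 2 (volume : Measure ℝ) := fun h hc =>
    (hcont h).memLp_of_hasCompactSupport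
      (hc.comp_left (g := fun y => (inner ℂ χ y : ℂ)) (inner_zero_right χ))
  have hLp : (hmem hF hFc).toLp = (hmem hG hGc).toLp := by
    refine ext_inner_left ℂ fun f => ?_
    have aux : ∀ {F : ℝ → E} (h : Continuous F) (hc : HasCompactSupport F),
        (inner ℂ f ((hmem h hc).toLp) : ℂ)
          = ∫ t, conj ((f : ℝ → ℂ) t) * inner ℂ χ (F t) := fun h hc => by
      rw [L2.inner_def]
      refine integral_congr_ae ?_
      filter_upwards [(hmem h hc).coeFn_toLp] with t ht
      rw [ht]; simp [mul_comm]
    rw [aux hF hFc, aux hG hGc]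
    have h1 := hxF (P.timeRep.symm f) χ
    have h2 := hxG (P.timeRep.symm f) χ
    rw [LinearIsometryEquiv.apply_symm_apply] at h1 h2
    rw [← h1, ← h2]
  have hae := (MemLp.toLp_eq_toLp_iff (hmem hF hFc) (hmem hG hGc)).1 hLp
  exact congrFun ((Continuous.ae_eq_iff_eq volume (hcont hF) (hcont hG)).1 hae) t

lemma waveFunction_add (P : PWSystem K E) (x y : P.testSpace) :
    P.waveFunction (x + y) = P.waveFunction x + P.waveFunction y := by
  refine IsWaveFunction.unique (P.continuous_waveFunction _) (P.hasCompactSupport_waveFunction _)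
    (P.isWaveFunction_waveFunction _)
    ((P.continuous_waveFunction x).add (P.continuous_waveFunction y))
    ((P.hasCompactSupport_waveFunction x).add (P.hasCompactSupport_waveFunction y))
    fun f χ => ?_
  rw [Submodule.coe_add, inner_add_right, P.isWaveFunction_waveFunction x f χ,
    P.isWaveFunction_waveFunction y f χ,
    ← integral_add (integrable_wave _ _ (P.continuous_waveFunction x)
      (P.hasCompactSupport_waveFunction x)) (integrable_wave _ _ (P.continuous_waveFunction y)
      (P.hasCompactSupport_waveFunction y))]
  simp [mul_add]

lemma waveFunction_smul (P : PWSystem K E) (c : ℂ) (x : P.testSpace) :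
    P.waveFunction (c • x) = c • P.waveFunction x := by
  refine IsWaveFunction.unique (P.continuous_waveFunction _) (P.hasCompactSupport_waveFunction _)
    (P.isWaveFunction_waveFunction _)
    ((P.continuous_waveFunction x).const_smul c)
    ((P.hasCompactSupport_waveFunction x).smul_left (f := fun _ => c))
    fun f χ => ?_
  rw [Submodule.coe_smul, inner_smul_right, P.isWaveFunction_waveFunction x f χ,
    ← integral_const_mul]
  refine integral_congr_ae (Filter.Eventually.of_forall fun t => ?_)
  simp only [Pi.smul_apply, inner_smul_right]
  ring

/-- Generalized vectors: antilinear functionals `η`, written `x ↦ ⟪x, η⟫`, on the test space. -/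
abbrev GeneralizedVector (P : PWSystem K E) : Type (max u v) := P.testSpace →ₗ⋆[ℂ] ℂ

/-- The generalized vector `|τ⟩ ψ`, where `|τ⟩` is the clock-reading vector `δ(· - τ)`:
`⟪x, |τ⟩ ψ⟫ = ⟪F(τ), ψ⟫` for a test vector `x` with wave function `F`. -/
def readingKet (P : PWSystem K E) (τ : ℝ) (ψ : E) : P.GeneralizedVector where
  toFun x := inner ℂ (P.waveFunction x τ) ψ
  map_add' x y := by simp [waveFunction_add]
  map_smul' c x := by simp [waveFunction_smul, mul_comm]

/-- The history `ψ(τ) = exp (-(i/ħ) H_r τ) ψ(0)` of the world with initial state `ψ(0)`. -/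
def history (P : PWSystem K E) (ħ : ℝ) (ψ₀ : E) (τ : ℝ) : E :=
  evolution ħ P.worldHamiltonian τ ψ₀

/-- The temporal state `|Ψ(τ)⟩ = |τ⟩ |ψ(τ)⟩` of the history starting at `|Ψ(0)⟩ = |0⟩ |ψ(0)⟩`. -/
def temporalState (P : PWSystem K E) (ħ : ℝ) (ψ₀ : E) (τ : ℝ) : P.GeneralizedVector :=
  P.readingKet τ (P.history ħ ψ₀ τ)

/-- `H_c ⊗ I + I ⊗ H_r` is closable on the algebraic tensor product of the domains, so that
`hamiltonian` is its closure and its graph is `tensorSumGraph`. -/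
lemma hamiltonian_graph (P : PWSystem K E) (ħ : ℝ) :
    (P.hamiltonian ħ).graph = tensorSumGraph (P.clockHamiltonian ħ) P.worldHamiltonian := by
  classical
  refine Submodule.toLinearPMap_graph_eq _ ?_
  have hd := Lp.dense_hasCompactSupport_contDiff (E := ℝ) (F := ℂ) (μ := (volume : Measure ℝ))
    (p := 2) (by norm_num)
  have hds : Dense ((P.timeRep.symm : L2R → K) '' _) :=
    P.timeRep.symm.surjective.denseRange.dense_image P.timeRep.symm.continuous hd
  choose! A₁ hA₁ using timeDeriv_formal_adjoint ħ
  refine fun p => tensorSumGraph_single_valued hds P.selfAdjoint.dense_domain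
    (A₀ := fun u => P.timeRep.symm (A₁ (P.timeRep u)))
    (B₀ := fun v => (if hv : v ∈ P.worldHamiltonian.domain then P.worldHamiltonian ⟨v, hv⟩ else 0))
    ?_ ?_ p
  · rintro x u ⟨g, hg, rfl⟩
    have h := hA₁ g hg ⟨P.timeRep x, x.2⟩
    rw [LinearIsometryEquiv.apply_symm_apply, ← LinearIsometryEquiv.inner_map_map P.timeRep (x : K),
      LinearIsometryEquiv.apply_symm_apply, ← h,
      ← LinearIsometryEquiv.inner_map_map P.timeRep.symm]
    rfl
  · intro y v hv
    have hdense := P.selfAdjoint.dense_domain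
    have h := LinearPMap.adjoint_isFormalAdjoint hdense
    rw [LinearPMap.isSelfAdjoint_def.1 P.selfAdjoint] at h
    simp only [SetLike.mem_coe] at hv
    rw [dif_pos hv]
    exact h y ⟨v, hv⟩

variable {K' : Type u'} {E' : Type v'}
  [NormedAddCommGroup K'] [InnerProductSpace ℂ K']
  [NormedAddCommGroup E'] [InnerProductSpace ℂ E'] [CompleteSpace E']

/-- The action on generalized vectors of a unitary `S` that maps the test space of `P` onto that of
`P'`: the vector `S η` is determined by `⟪S x, S η⟫ = ⟪x, η⟫`, i.e. `⟪y, S η⟫ = ⟪S⁻¹ y, η⟫`. -/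
def mapGeneralized {P : PWSystem K E} {P' : PWSystem K' E'}
    (S : HilbertTensor K E ≃ₗᵢ[ℂ] HilbertTensor K' E')
    (hS : ∀ x, x ∈ P.testSpace ↔ S x ∈ P'.testSpace)
    (η : P.GeneralizedVector) : P'.GeneralizedVector where
  toFun y := η ⟨S.symm y, (hS _).2 (by simp)⟩
  map_add' y z := by
    rw [← map_add]; congr 1; ext; simp
  map_smul' c y := by
    rw [← LinearMap.map_smulₛₗ]; congr 1; ext; simp

end PWSystem

end PageWootters

end

/-! In the time representation a vector is a function F : ℝ → H_r, and the total Hamiltonian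
generates G(s), where (G(s)F)(t) = U(s)F(t − s) and U is the evolution of the world. The
substitution F(t) ↦ U(−t)F(t) turns G into pure translation, so the world Hamiltonian can be gauged
away and any other one gauged in. Take a unitary V : H_r → H_r' with Vψ(0) = ψ'(0), and let S be
multiplication by W(t) = U'(t) V U(−t). Then W(t)U(s) = U'(s)W(t − s), which says that S G(s) =
G'(s) S (`waveMul_totalGroup`, `intertwiner_comp`). Hence S conjugates the generators, domains
included. Since W and its pointwise inverse are jointly continuous, S matches the two test spaces;
and W(τ)ψ(τ) = ψ'(τ) moves one history to the other.

The analytic work is to show that the closure of H_c ⊗ I + I ⊗ H_r is the full generator of G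
(`mem_graph_hamiltonian_iff`). Three facts enter: Stone's theorem for H_r, proved with commuting
Yosida approximations (`exists_isEvolutionGroup`); strong differentiability of translates of a
function with a weak derivative in L² (`hasDerivAt_translation`); and the core criterion that a
closed restriction of a generator with dense invariant domain is the whole generator
(`mem_of_hasDerivAt`), applied to T ⊗ U in `mem_tensorSumGraph_iff`.

V exists because equal dimension gives some unitary, and the unitary group acts transitively on
spheres (`exists_unitary_apply_eq`). -/

noncomputable section

namespace PageWootters

/-! ### One-parameter unitary groups and their generators -/

section UnitaryGroups

open Filter Topology

variable {X : Type u} [NormedAddCommGroup X] [InnerProductSpace ℂ X]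

/-- A strongly continuous one-parameter unitary group. -/
structure IsUnitaryGroup (U : ℝ → (X ≃ₗᵢ[ℂ] X)) : Prop where
  add : ∀ (s t : ℝ) (x : X), U (s + t) x = U s (U t x)
  continuous : ∀ x : X, Continuous fun t => U t x

lemma IsEvolutionGroup.isUnitaryGroup {ħ : ℝ} {A : X →ₗ.[ℂ] X} {U : ℝ → (X ≃ₗᵢ[ℂ] X)}
    (h : IsEvolutionGroup ħ A U) : IsUnitaryGroup U :=
  ⟨h.add, h.continuous⟩

namespace IsUnitaryGroup

variable {U : ℝ → (X ≃ₗᵢ[ℂ] X)}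

lemma zero_apply (hU : IsUnitaryGroup U) (x : X) : U 0 x = x := by
  apply (U 0).injective
  rw [← hU.add, add_zero]

lemma apply_neg_apply (hU : IsUnitaryGroup U) (t : ℝ) (x : X) : U t (U (-t) x) = x := by
  rw [← hU.add, add_neg_cancel, hU.zero_apply]

lemma neg_apply_apply (hU : IsUnitaryGroup U) (t : ℝ) (x : X) : U (-t) (U t x) = x := by
  rw [← hU.add, neg_add_cancel, hU.zero_apply]

/-- Strong continuity suffices because each `U t` is an isometry: moving the vector costs the same
distance at every time. Joint continuity is what later makes multiplication by W preserve
measurability and continuity. -/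
lemma continuous_uncurry (hU : IsUnitaryGroup U) : Continuous fun p : ℝ × X => U p.1 p.2 := by
  refine continuous_iff_continuousAt.2 fun p => ?_
  have h1 : Tendsto (fun q : ℝ × X => U q.1 p.2) (𝓝 p) (𝓝 (U p.1 p.2)) :=
    ((hU.continuous p.2).comp continuous_fst).tendsto p
  refine tendsto_of_tendsto_of_dist h1 ?_
  have h2 : Tendsto (fun q : ℝ × X => dist p.2 q.2) (𝓝 p) (𝓝 0) := by
    have : Continuous fun q : ℝ × X => dist p.2 q.2 := by fun_prop
    simpa using this.tendsto p
  simpa using h2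

lemma hasDerivAt (hU : IsUnitaryGroup U) {x z : X} (h : HasDerivAt (fun t => U t x) z 0) (t : ℝ) :
    HasDerivAt (fun t => U t x) (U t z) t := by
  have h1 : HasDerivAt (fun s => U (s - t) x) z t := by
    refine HasDerivAt.comp_sub_const (f := fun s => U s x) t t ?_
    simpa using h
  have h2 := ((U t).toContinuousLinearEquiv : X →L[ℂ] X).hasFDerivAt.restrictScalars ℝ
    |>.comp_hasDerivAt t h1
  refine h2.congr_of_eventuallyEq (Eventually.of_forall fun s => ?_)
  change U s x = U t (U (s - t) x)
  rw [← hU.add, add_sub_cancel]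

lemma hasDerivAt_apply (hU : IsUnitaryGroup U) {x z : X} (h : HasDerivAt (fun t => U t x) z 0)
    (s : ℝ) : HasDerivAt (fun t => U t (U s x)) (U s z) 0 := by
  have h2 := ((U s).toContinuousLinearEquiv : X →L[ℂ] X).hasFDerivAt.restrictScalars ℝ
    |>.comp_hasDerivAt 0 h
  refine h2.congr_of_eventuallyEq (Eventually.of_forall fun t => ?_)
  change U t (U s x) = U s (U t x)
  rw [← hU.add, ← hU.add, add_comm]

variable [CompleteSpace X]

/-- The operator `x ↦ ∫₀ᵗ U s x ds`. -/
def integral (hU : IsUnitaryGroup U) (t : ℝ) : X →L[ℂ] X :=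
  LinearMap.mkContinuous
    { toFun := fun x => ∫ s in (0 : ℝ)..t, U s x
      map_add' := fun x y => by
        simp only [map_add]
        exact intervalIntegral.integral_add ((hU.continuous x).intervalIntegrable _ _)
          ((hU.continuous y).intervalIntegrable _ _)
      map_smul' := fun c x => by
        simp only [map_smul, RingHom.id_apply]
        exact intervalIntegral.integral_smul c _ } |t| fun x => by
    have := intervalIntegral.norm_integral_le_of_norm_le_const (a := 0) (b := t)
      (f := fun s => U s x) (C := ‖x‖) (fun s _ => by simp)
    rw [sub_zero, mul_comm] at this
    exact this

omit [CompleteSpace X] in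
lemma integral_apply (hU : IsUnitaryGroup U) (t : ℝ) (x : X) :
    hU.integral t x = ∫ s in (0 : ℝ)..t, U s x := rfl

lemma hasDerivAt_integral (hU : IsUnitaryGroup U) (x : X) :
    HasDerivAt (fun t => hU.integral t x) x 0 := by
  have h := intervalIntegral.integral_hasDerivAt_right (f := fun s => U s x) (a := 0) (b := 0)
    ((hU.continuous x).intervalIntegrable _ _)
    ((hU.continuous x).stronglyMeasurableAtFilter _ _) (hU.continuous x).continuousAt
  rw [hU.zero_apply] at h
  exact h

/-- Integrating the derivative along the orbit replaces differentiability by equations between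
bounded operators, which survive limits. Closedness of generators, Stone's theorem and the
translation group all use this form. -/
lemma hasDerivAt_iff (hU : IsUnitaryGroup U) {x z : X} :
    HasDerivAt (fun t => U t x) z 0 ↔ ∀ t, U t x - x = hU.integral t z := by
  constructor
  · intro h t
    have := intervalIntegral.integral_eq_sub_of_hasDerivAt (a := 0) (b := t)
      (fun s _ => hU.hasDerivAt h s) ((hU.continuous z).intervalIntegrable _ _)
    rw [hU.zero_apply] at this
    exact this.symm
  · intro h
    refine ((hU.hasDerivAt_integral z).add_const x).congr_of_eventuallyEq
      (Eventually.of_forall fun t => ?_)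
    change U t x = hU.integral t z + x
    rw [← h t, sub_add_cancel]

lemma isClosed_generator (hU : IsUnitaryGroup U) (c : ℂ) :
    IsClosed {p : X × X | HasDerivAt (fun t => U t p.1) (c • p.2) 0} := by
  have : {p : X × X | HasDerivAt (fun t => U t p.1) (c • p.2) 0} =
      ⋂ t : ℝ, {p : X × X | U t p.1 - p.1 = hU.integral t (c • p.2)} := by
    ext p
    simp only [Set.mem_iInter]
    exact hU.hasDerivAt_iff
  rw [this]
  refine isClosed_iInter fun t => isClosed_eq ?_ ?_
  · exact ((U t).continuous.comp continuous_fst).sub continuous_fst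
  · exact (hU.integral t).continuous.comp (continuous_snd.const_smul c)

/-- A closed restriction of the generator whose domain is dense and invariant under the group is
the whole generator. -/
lemma mem_of_hasDerivAt (hU : IsUnitaryGroup U) {c : ℂ} (hc : c ≠ 0)
    (Γ : Submodule ℂ (X × X)) (hcl : IsClosed (Γ : Set (X × X)))
    (hgen : ∀ p ∈ Γ, HasDerivAt (fun t => U t p.1) (c • p.2) 0)
    (hinv : ∀ p ∈ Γ, ∀ t, (U t p.1, U t p.2) ∈ Γ)
    (hdense : Dense (Prod.fst '' (Γ : Set (X × X)))) {x y : X}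
    (hxy : HasDerivAt (fun t => U t x) (c • y) 0) : (x, y) ∈ Γ := by
  -- Completeness of Γ allows the orbit of a pair to be integrated inside Γ, so that time averages
  -- stay in Γ.
  have : CompleteSpace Γ := hcl.completeSpace_coe
  have h1 : ∀ p ∈ Γ, ∀ t : ℝ, (hU.integral t p.1, c⁻¹ • (U t p.1 - p.1)) ∈ Γ := by
    intro p hp t
    let γ : ℝ → Γ := fun s => ⟨(U s p.1, U s p.2), hinv p hp s⟩
    have hγ : Continuous γ :=
      ((hU.continuous p.1).prodMk (hU.continuous p.2)).subtype_mk _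
    have hi := hγ.intervalIntegrable (μ := volume) 0 t
    have e1 := ((ContinuousLinearMap.fst ℂ X X).comp Γ.subtypeL).intervalIntegral_comp_comm hi
    have e2 := ((ContinuousLinearMap.snd ℂ X X).comp Γ.subtypeL).intervalIntegral_comp_comm hi
    have e3 := hU.hasDerivAt_iff.1 (hgen p hp) t
    have : ((∫ s in (0 : ℝ)..t, γ s : Γ) : X × X) =
        (hU.integral t p.1, c⁻¹ • (U t p.1 - p.1)) := by
      refine Prod.ext ?_ ?_
      · exact e1.symm
      · rw [e3, map_smul, inv_smul_smul₀ hc]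
        exact e2.symm
    rw [← this]
    exact Subtype.property _
  -- Both components are now bounded functions of `x` alone, so density of the domain removes the
  -- assumption that `x` belongs to it.
  have h2 : ∀ (x : X) (t : ℝ), (hU.integral t x, c⁻¹ • (U t x - x)) ∈ Γ := by
    intro x t
    have hclx : IsClosed {x : X | (hU.integral t x, c⁻¹ • (U t x - x)) ∈ (Γ : Set (X × X))} := by
      refine hcl.preimage ?_
      exact (hU.integral t).continuous.prodMk
        (((U t).continuous.sub continuous_id).const_smul _)
    refine closure_minimal ?_ hclx (hdense x)
    rintro _ ⟨p, hp, rfl⟩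
    exact h1 p hp t
  -- Divided by t, the pairs of `h2` tend to (x, y) as t → 0, and Γ is closed.
  have l1 := (hU.hasDerivAt_integral x).tendsto_slope
  have l2 := (hxy.tendsto_slope).const_smul c⁻¹
  rw [inv_smul_smul₀ hc] at l2
  refine hcl.mem_of_tendsto (l1.prodMk_nhds l2) (Eventually.of_forall fun t => ?_)
  have h0 : hU.integral 0 x = 0 := by simp [integral_apply]
  have h3 := Γ.smul_mem (((t - 0)⁻¹ : ℝ) : ℂ) (h2 x t)
  simp only [slope, h0, hU.zero_apply, vsub_eq_sub, sub_zero] at h3 ⊢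
  convert h3 using 1
  rw [Prod.smul_mk]
  rw [smul_comm c⁻¹ (t⁻¹ : ℝ)]
  rfl

end IsUnitaryGroup

end UnitaryGroups

/-! ### Limits of contractions and of unitary groups -/

section Limits

open Filter Topology

variable {X : Type u} [NormedAddCommGroup X] [InnerProductSpace ℂ X]

-- An ε/3 argument: contractions transfer the Cauchy property from nearby vectors. Convergence thus
-- needs checking only on a dense domain.
omit [InnerProductSpace ℂ X] in
lemma isClosed_setOf_cauchySeq {f : ℕ → X → X} (hf : ∀ n x y, ‖f n x - f n y‖ ≤ ‖x - y‖) :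
    IsClosed {x | CauchySeq fun n => f n x} := by
  refine isClosed_of_closure_subset fun x hx => ?_
  refine Metric.cauchySeq_iff'.2 fun ε hε => ?_
  obtain ⟨y, hy, hxy⟩ := Metric.mem_closure_iff.1 hx (ε / 3) (by positivity)
  obtain ⟨N, hN⟩ := Metric.cauchySeq_iff'.1 hy (ε / 3) (by positivity)
  refine ⟨N, fun n hn => ?_⟩
  have h1 := hN n hn
  have h2 := hf n x y
  have h3 := hf N x y
  rw [← dist_eq_norm, ← dist_eq_norm] at h2 h3
  have h4 := dist_triangle4 (f n x) (f n y) (f N y) (f N x)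
  rw [dist_comm (f N y) (f N x)] at h4
  linarith

omit [InnerProductSpace ℂ X] in
lemma isClosed_setOf_tendsto {f : ℕ → X → X} (hf : ∀ n x y, ‖f n x - f n y‖ ≤ ‖x - y‖) :
    IsClosed {x | Tendsto (fun n => f n x) atTop (𝓝 x)} := by
  refine isClosed_of_closure_subset fun x hx => ?_
  refine Metric.tendsto_atTop.2 fun ε hε => ?_
  obtain ⟨y, hy, hxy⟩ := Metric.mem_closure_iff.1 hx (ε / 3) (by positivity)
  obtain ⟨N, hN⟩ := Metric.tendsto_atTop.1 hy (ε / 3) (by positivity)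
  refine ⟨N, fun n hn => ?_⟩
  have h1 := hN n hn
  have h2 := hf n x y
  rw [← dist_eq_norm, ← dist_eq_norm] at h2
  have h4 := dist_triangle4 (f n x) (f n y) y x
  rw [dist_comm y x] at h4
  linarith

/-- Orbits of nearby vectors are uniformly close in t, and uniform limits of continuous functions
are continuous. -/
lemma isClosed_setOf_continuous_orbit {U : ℝ → (X ≃ₗᵢ[ℂ] X)} :
    IsClosed {x | Continuous fun t => U t x} := by
  refine isClosed_of_closure_subset fun x hx => ?_
  refine continuous_of_uniform_approx_of_continuous fun u hu => ?_
  obtain ⟨ε, hε, hεu⟩ := Metric.mem_uniformity_dist.1 hu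
  obtain ⟨y, hy, hxy⟩ := Metric.mem_closure_iff.1 hx ε hε
  exact ⟨fun t => U t y, hy, fun t => hεu (by simpa using hxy)⟩

/-- A family of isometric operators `U t` with `U 0 = 1` and `U (s + t) = U s U t`, as a family of
unitary operators. -/
def unitaryFamily (U : ℝ → X →ₗᵢ[ℂ] X) (h0 : ∀ x, U 0 x = x)
    (hadd : ∀ s t x, U (s + t) x = U s (U t x)) (t : ℝ) : X ≃ₗᵢ[ℂ] X where
  toLinearEquiv := LinearEquiv.ofLinearMap (U t).toLinearMap (U (-t)).toLinearMap
    (by ext x; change U t (U (-t) x) = x; rw [← hadd, add_neg_cancel, h0])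
    (by ext x; change U (-t) (U t x) = x; rw [← hadd, neg_add_cancel, h0])
  norm_map' := (U t).norm_map

/-- A pointwise limit of unitary groups is a group of unitary operators. -/
lemma exists_limit_group [CompleteSpace X] {V : ℕ → ℝ → (X ≃ₗᵢ[ℂ] X)}
    (hV : ∀ n, IsUnitaryGroup (V n)) (hc : ∀ t x, CauchySeq fun n => V n t x) :
    ∃ U : ℝ → (X ≃ₗᵢ[ℂ] X), (∀ s t x, U (s + t) x = U s (U t x)) ∧
      ∀ t x, Tendsto (fun n => V n t x) atTop (𝓝 (U t x)) := by
  choose L hL using fun t x => cauchySeq_tendsto_of_complete (hc t x)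
  let U : ℝ → X →ₗᵢ[ℂ] X := fun t =>
    { toFun := L t
      map_add' := fun x y => tendsto_nhds_unique (hL t (x + y)) (by
        simpa only [map_add] using (hL t x).add (hL t y))
      map_smul' := fun c x => tendsto_nhds_unique (hL t (c • x)) (by
        simpa only [map_smul] using! (hL t x).const_smul c)
      norm_map' := fun x => tendsto_nhds_unique (hL t x).norm (by
        simp only [LinearIsometryEquiv.norm_map]
        exact tendsto_const_nhds) }
  have hU : ∀ t x, Tendsto (fun n => V n t x) atTop (𝓝 (U t x)) := hL
  have h0 : ∀ x, U 0 x = x := fun x => tendsto_nhds_unique (hU 0 x) (by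
    simp only [(hV _).zero_apply]
    exact tendsto_const_nhds)
  have hadd : ∀ s t x, U (s + t) x = U s (U t x) := fun s t x =>
    tendsto_nhds_unique (hU (s + t) x) (by
      -- `V n s` is isometric, so replacing `V n t x` by its limit inside it costs only the distance
      -- to that limit.
      refine tendsto_of_tendsto_of_dist (hU s (U t x)) ?_
      have h := tendsto_iff_dist_tendsto_zero.1 (hU t x)
      refine h.congr fun n => ?_
      rw [(hV n).add, LinearIsometryEquiv.dist_map, dist_comm])
  exact ⟨unitaryFamily U h0 hadd, hadd, hU⟩

end Limits

/-! ### Unitary groups with bounded generators -/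

section BoundedGenerators

variable {E : Type u} [NormedAddCommGroup E] [InnerProductSpace ℂ E] [CompleteSpace E]

lemma exp_smul_mem_unitary {X : E →L[ℂ] E} (hX : X ∈ skewAdjoint (E →L[ℂ] E)) (t : ℝ) :
    NormedSpace.exp (t • X) ∈ unitary (E →L[ℂ] E) := by
  let _ : NormedAlgebra ℚ (E →L[ℂ] E) := NormedAlgebra.restrictScalars ℚ ℝ _
  exact NormedSpace.exp_mem_unitary_of_mem_skewAdjoint (skewAdjoint.smul_mem t hX)

/-- The unitary group `exp (t X)` with skew-adjoint bounded generator `X`. -/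
def expGroup {X : E →L[ℂ] E} (hX : X ∈ skewAdjoint (E →L[ℂ] E)) (t : ℝ) : E ≃ₗᵢ[ℂ] E :=
  Unitary.linearIsometryEquiv ⟨NormedSpace.exp (t • X), exp_smul_mem_unitary hX t⟩

lemma expGroup_apply {X : E →L[ℂ] E} (hX : X ∈ skewAdjoint (E →L[ℂ] E)) (t : ℝ) (x : E) :
    expGroup hX t x = NormedSpace.exp (t • X) x := rfl

lemma hasDerivAt_expGroup {X : E →L[ℂ] E} (hX : X ∈ skewAdjoint (E →L[ℂ] E)) (x : E) (t : ℝ) :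
    HasDerivAt (fun t => expGroup hX t x) (expGroup hX t (X x)) t := by
  have h := hasDerivAt_exp_smul_const (𝕂 := ℝ) X t
  exact ((ContinuousLinearMap.apply ℂ E x).hasFDerivAt.restrictScalars ℝ).comp_hasDerivAt t h

lemma expGroup_add_of_commute {X Y Z : E →L[ℂ] E} (hX : X ∈ skewAdjoint (E →L[ℂ] E))
    (hY : Y ∈ skewAdjoint (E →L[ℂ] E)) (hZ : Z ∈ skewAdjoint (E →L[ℂ] E)) {r s t : ℝ}
    (h : r • Z = s • X + t • Y) (hc : Commute X Y) (x : E) :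
    expGroup hZ r x = expGroup hX s (expGroup hY t x) := by
  let _ : NormedAlgebra ℚ (E →L[ℂ] E) := NormedAlgebra.restrictScalars ℚ ℝ _
  rw [expGroup_apply, h, NormedSpace.exp_add_of_commute ((hc.smul_left s).smul_right t)]
  rfl

lemma isUnitaryGroup_expGroup {X : E →L[ℂ] E} (hX : X ∈ skewAdjoint (E →L[ℂ] E)) :
    IsUnitaryGroup (expGroup hX) where
  add s t x := expGroup_add_of_commute hX hX hX (add_smul s t X) (Commute.refl X) x
  continuous x := continuous_iff_continuousAt.2 fun t => (hasDerivAt_expGroup hX x t).continuousAt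

lemma hasDerivAt_expGroup_zero {X : E →L[ℂ] E} (hX : X ∈ skewAdjoint (E →L[ℂ] E)) (x : E) :
    HasDerivAt (fun t => expGroup hX t x) (X x) 0 := by
  simpa only [(isUnitaryGroup_expGroup hX).zero_apply] using hasDerivAt_expGroup hX x 0

lemma norm_expGroup_sub_le {X : E →L[ℂ] E} (hX : X ∈ skewAdjoint (E →L[ℂ] E)) (t : ℝ) (x : E) :
    ‖expGroup hX t x - x‖ ≤ |t| * ‖X x‖ := by
  rw [(isUnitaryGroup_expGroup hX).hasDerivAt_iff.1 (hasDerivAt_expGroup_zero hX x) t]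
  exact (LinearMap.mkContinuous_norm_le _ (abs_nonneg t) _ |> ContinuousLinearMap.le_of_opNorm_le _)
    _

/-- For commuting generators exp(tY) = exp(tX) exp(t(Y − X)); the isometric factor exp(tX) drops out
of the norm, leaving the displacement of one group. -/
lemma norm_expGroup_sub_expGroup_le {X Y : E →L[ℂ] E} (hX : X ∈ skewAdjoint (E →L[ℂ] E))
    (hY : Y ∈ skewAdjoint (E →L[ℂ] E)) (hc : Commute X Y) (t : ℝ) (x : E) :
    ‖expGroup hY t x - expGroup hX t x‖ ≤ |t| * ‖Y x - X x‖ := by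
  have hD : Y - X ∈ skewAdjoint (E →L[ℂ] E) := sub_mem hY hX
  have h := expGroup_add_of_commute hX hD hY (r := t) (s := t) (t := t) (by module)
    (hc.sub_right (Commute.refl X)) x
  rw [h, ← map_sub, LinearIsometryEquiv.norm_map]
  exact norm_expGroup_sub_le hD t x

end BoundedGenerators

/-! ### Resolvents of self-adjoint operators -/

section Resolvent

variable {E : Type u} [NormedAddCommGroup E] [InnerProductSpace ℂ E] [CompleteSpace E]
  {A : E →ₗ.[ℂ] E}

open Complex

/-- A coincides with its adjoint, whose graph is defined by this test. Membership in the domain is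
thereby reduced to an inner product identity. -/
lemma mem_graph_iff_of_isSelfAdjoint (hA : IsSelfAdjoint A) {x y : E} :
    (x, y) ∈ A.graph ↔ ∀ a b, (a, b) ∈ A.graph → (inner ℂ b x : ℂ) = inner ℂ a y := by
  conv_lhs => rw [← LinearPMap.isSelfAdjoint_def.1 hA,
    LinearPMap.adjoint_graph_eq_graph_adjoint hA.dense_domain]
  simp only [Submodule.mem_adjoint_iff, sub_eq_zero]

/-- ⟪Ax, x⟫ is real, so the cross term with the imaginary multiple of x has zero real part. -/
lemma norm_sq_add_smul_of_mem_graph (hA : IsSelfAdjoint A) {x y : E} (h : (x, y) ∈ A.graph)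
    (l : ℝ) : ‖y + (I * l) • x‖ ^ 2 = ‖y‖ ^ 2 + l ^ 2 * ‖x‖ ^ 2 := by
  have h1 : (inner ℂ y x : ℂ) = inner ℂ x y := (mem_graph_iff_of_isSelfAdjoint hA).1 h x y h
  have h2 : (inner ℂ y x : ℂ).im = 0 := by
    rw [← inner_conj_symm] at h1
    have := congrArg Complex.im h1
    simp only [conj_im] at this
    rw [← inner_conj_symm, conj_im]
    linarith
  rw [norm_add_sq (𝕜 := ℂ), inner_smul_right, norm_smul, mul_pow]
  simp [h2]

lemma eq_zero_of_mem_graph_smul (hA : IsSelfAdjoint A) {l : ℝ} (hl : l ≠ 0) {x : E}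
    (h : (x, (I * l) • x) ∈ A.graph) : x = 0 := by
  have h1 := norm_sq_add_smul_of_mem_graph hA h (-l)
  have h2 : (I * (l : ℂ)) • x + (I * ((-l : ℝ) : ℂ)) • x = 0 := by
    push_cast; module
  rw [h2, norm_zero, norm_smul] at h1
  have h3 : ‖x‖ ^ 2 = 0 := by
    have h5 : 0 < l ^ 2 := by positivity
    simp only [Complex.norm_mul, norm_I, norm_real, one_mul, mul_pow, Real.norm_eq_abs,
      sq_abs] at h1
    have : l ^ 2 * ‖x‖ ^ 2 = 0 := by linarith
    exact (mul_eq_zero.1 this).resolve_left h5.ne'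
  simpa using h3

/-- The operator `A + i l` on the graph of `A`. -/
def shiftMap (A : E →ₗ.[ℂ] E) (l : ℝ) : A.graph →L[ℂ] E :=
  (ContinuousLinearMap.snd ℂ E E + (I * (l : ℂ)) • ContinuousLinearMap.fst ℂ E E).comp
    A.graph.subtypeL

omit [CompleteSpace E] in
lemma shiftMap_apply (l : ℝ) (p : A.graph) :
    shiftMap A l p = (p : E × E).2 + (I * (l : ℂ)) • (p : E × E).1 := rfl

lemma norm_fst_le_shiftMap (hA : IsSelfAdjoint A) {l : ℝ} (hl : l ≠ 0) (p : A.graph) :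
    ‖(p : E × E).1‖ ≤ |l|⁻¹ * ‖shiftMap A l p‖ := by
  have h := norm_sq_add_smul_of_mem_graph hA p.2 l
  rw [inv_mul_eq_div, le_div_iff₀ (by positivity), shiftMap_apply]
  refine abs_le_of_sq_le_sq' ?_ (norm_nonneg _) |>.2
  rw [h, mul_pow, sq_abs]
  nlinarith [sq_nonneg ‖(p : E × E).2‖]

lemma norm_snd_le_shiftMap (hA : IsSelfAdjoint A) (l : ℝ) (p : A.graph) :
    ‖(p : E × E).2‖ ≤ ‖shiftMap A l p‖ := by
  have h := norm_sq_add_smul_of_mem_graph hA p.2 l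
  rw [shiftMap_apply]
  refine abs_le_of_sq_le_sq' ?_ (norm_nonneg _) |>.2
  rw [h]
  nlinarith [mul_nonneg (sq_nonneg l) (sq_nonneg ‖(p : E × E).1‖)]

lemma bijective_shiftMap (hA : IsSelfAdjoint A) {l : ℝ} (hl : l ≠ 0) :
    Function.Bijective (shiftMap A l) := by
  -- The graph carries the maximum norm of the product: `|l|⁻¹` bounds the first component and `1`
  -- the second.
  have hanti : AntilipschitzWith (Real.toNNReal (max |l|⁻¹ 1)) (shiftMap A l) := by
    refine AddMonoidHomClass.antilipschitz_of_bound _ fun p => ?_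
    rw [Real.coe_toNNReal _ (le_max_of_le_right zero_le_one)]
    refine max_le ?_ ?_
    · exact (norm_fst_le_shiftMap hA hl p).trans
        (mul_le_mul_of_nonneg_right (le_max_left _ _) (norm_nonneg _))
    · refine (norm_snd_le_shiftMap hA l p).trans ?_
      exact le_mul_of_one_le_left (norm_nonneg _) (le_max_right _ _)
  refine ⟨hanti.injective, ?_⟩
  have : CompleteSpace A.graph := IsClosed.completeSpace_coe (hs := hA.isClosed)
  have hcl : IsClosed (Set.range (shiftMap A l)) :=
    hanti.isClosed_range (shiftMap A l).uniformContinuous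
  -- A vector z orthogonal to the range passes the self-adjointness test with Az = i l z, and a
  -- self-adjoint operator has no non-real eigenvalue.
  have horth : (LinearMap.range (shiftMap A l).toLinearMap)ᗮ = ⊥ := by
    rw [Submodule.eq_bot_iff]
    intro z hz
    refine eq_zero_of_mem_graph_smul hA hl ((mem_graph_iff_of_isSelfAdjoint hA).2 fun a b hab => ?_)
    have h := Submodule.mem_orthogonal _ _ |>.1 hz (shiftMap A l ⟨(a, b), hab⟩) ⟨_, rfl⟩
    rw [shiftMap_apply, inner_add_left, inner_smul_left] at h
    simp only [map_mul, conj_I, conj_ofReal] at h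
    rw [inner_smul_right]
    linear_combination h
  have htop := Submodule.topologicalClosure_eq_top_iff.2 horth
  rw [IsClosed.submodule_topologicalClosure_eq
    (show IsClosed (Set.range (shiftMap A l)) from hcl)] at htop
  exact LinearMap.range_eq_top.1 htop

open scoped Classical in
/-- The resolvent `(A + i l)⁻¹` of a self-adjoint operator, for real `l ≠ 0`. -/
def resolventI (hA : IsSelfAdjoint A) {l : ℝ} (hl : l ≠ 0) : E →L[ℂ] E :=
  LinearMap.mkContinuous
    ((LinearMap.fst ℂ E E ∘ₗ A.graph.subtype) ∘ₗ
      (LinearEquiv.ofBijective (shiftMap A l).toLinearMap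
        (bijective_shiftMap hA hl)).symm.toLinearMap)
    |l|⁻¹ fun z => by
      refine (norm_fst_le_shiftMap hA hl _).trans ?_
      refine le_of_eq ?_
      congr 2
      exact (LinearEquiv.ofBijective (shiftMap A l).toLinearMap
        (bijective_shiftMap hA hl)).apply_symm_apply z

lemma norm_resolventI_apply_le (hA : IsSelfAdjoint A) {l : ℝ} (hl : l ≠ 0) (z : E) :
    ‖resolventI hA hl z‖ ≤ |l|⁻¹ * ‖z‖ :=
  ContinuousLinearMap.le_of_opNorm_le _ (LinearMap.mkContinuous_norm_le _ (by positivity) _) z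

lemma resolventI_apply (hA : IsSelfAdjoint A) {l : ℝ} (hl : l ≠ 0) {x y : E}
    (h : (x, y) ∈ A.graph) : resolventI hA hl (y + (I * (l : ℂ)) • x) = x := by
  have : (LinearEquiv.ofBijective (shiftMap A l).toLinearMap (bijective_shiftMap hA hl)).symm
      (y + (I * (l : ℂ)) • x) = ⟨(x, y), h⟩ := by
    rw [LinearEquiv.symm_apply_eq]
    rfl
  change ((LinearEquiv.ofBijective (shiftMap A l).toLinearMap (bijective_shiftMap hA hl)).symm
      (y + (I * (l : ℂ)) • x) : E × E).1 = x
  rw [this]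

lemma resolventI_mem_graph (hA : IsSelfAdjoint A) {l : ℝ} (hl : l ≠ 0) (z : E) :
    (resolventI hA hl z, z - (I * (l : ℂ)) • resolventI hA hl z) ∈ A.graph := by
  obtain ⟨⟨⟨x, y⟩, h⟩, rfl⟩ := (bijective_shiftMap hA hl).2 z
  simp only [shiftMap_apply]
  rw [resolventI_apply hA hl h, add_sub_cancel_right]
  exact h

lemma resolventI_inner (hA : IsSelfAdjoint A) {l : ℝ} (hl : l ≠ 0) (hl' : -l ≠ 0) (z w : E) :
    (inner ℂ (resolventI hA hl z) w : ℂ) = inner ℂ z (resolventI hA hl' w) := by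
  have h := (mem_graph_iff_of_isSelfAdjoint hA).1 (resolventI_mem_graph hA hl' w) _ _
    (resolventI_mem_graph hA hl z)
  rw [inner_sub_left, inner_sub_right, inner_smul_left, inner_smul_right] at h
  simp only [map_mul, conj_I, conj_ofReal, ofReal_neg] at h
  linear_combination -h

lemma resolventI_sub (hA : IsSelfAdjoint A) {l m : ℝ} (hl : l ≠ 0) (hm : m ≠ 0) (z : E) :
    resolventI hA hl z - resolventI hA hm z =
      (I * ((m : ℂ) - l)) • resolventI hA hm (resolventI hA hl z) := by
  have h := resolventI_apply hA hm (resolventI_mem_graph hA hl z)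
  rw [map_add, map_sub, map_smul, map_smul] at h
  nth_rw 1 [← h]
  module

/-- Exchanging l and m in the resolvent identity changes the sign of both sides; the two versions
agree only if the products do. -/
lemma commute_resolventI (hA : IsSelfAdjoint A) {l m : ℝ} (hl : l ≠ 0) (hm : m ≠ 0) :
    Commute (resolventI hA hl) (resolventI hA hm) := by
  by_cases hlm : l = m
  · subst hlm; exact Commute.refl _
  · refine ContinuousLinearMap.ext fun z => ?_
    change resolventI hA hl (resolventI hA hm z) = resolventI hA hm (resolventI hA hl z)
    have h1 := resolventI_sub hA hl hm z
    have h2 := resolventI_sub hA hm hl z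
    have hne : I * ((m : ℂ) - l) ≠ 0 :=
      mul_ne_zero I_ne_zero (sub_ne_zero.2 fun h => hlm (ofReal_injective h.symm))
    have h3 : (I * ((m : ℂ) - l)) • resolventI hA hl (resolventI hA hm z) =
        (I * ((m : ℂ) - l)) • resolventI hA hm (resolventI hA hl z) := by
      rw [← h1, ← neg_sub (resolventI hA hm z), h2, ← neg_smul]
      congr 1
      ring
    exact smul_right_injective E hne h3

/-- The bounded self-adjoint approximation `l² A (l² + A²)⁻¹` of `A`. -/
def yosida (hA : IsSelfAdjoint A) {l : ℝ} (hl : l ≠ 0) : E →L[ℂ] E :=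
  ((l : ℂ) ^ 2 / 2) • (resolventI hA hl + resolventI hA (neg_ne_zero.2 hl))

/-- The contraction `l² (l² + A²)⁻¹`. -/
def yosidaContraction (hA : IsSelfAdjoint A) {l : ℝ} (hl : l ≠ 0) : E →L[ℂ] E :=
  (I * (l : ℂ) / 2) • (resolventI hA hl - resolventI hA (neg_ne_zero.2 hl))

/-- The approximation is the contraction l²(l² + A²)⁻¹ applied after A. Its convergence on the
domain of A therefore follows from strong convergence of the contractions to the identity. -/
lemma yosida_apply_of_mem_graph (hA : IsSelfAdjoint A) {l : ℝ} (hl : l ≠ 0) {x y : E}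
    (h : (x, y) ∈ A.graph) : yosida hA hl x = yosidaContraction hA hl y := by
  have h1 := resolventI_apply hA hl h
  have h2 := resolventI_apply hA (neg_ne_zero.2 hl) h
  rw [map_add, map_smul, ← eq_sub_iff_add_eq] at h1 h2
  simp only [yosida, yosidaContraction, smul_apply,
    add_apply, sub_apply, h1, h2, ofReal_neg]
  have hI := I_sq
  match_scalars
  · linear_combination ((l : ℂ) ^ 2 / 2) * hI
  · linear_combination ((l : ℂ) ^ 2 / 2) * hI
  · ring

lemma norm_yosidaContraction_apply_le (hA : IsSelfAdjoint A) {l : ℝ} (hl : l ≠ 0) (y : E) :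
    ‖yosidaContraction hA hl y‖ ≤ ‖y‖ := by
  have h1 := norm_resolventI_apply_le hA hl y
  have h2 := norm_resolventI_apply_le hA (neg_ne_zero.2 hl) y
  rw [abs_neg] at h2
  have h3 := norm_sub_le (resolventI hA hl y) (resolventI hA (neg_ne_zero.2 hl) y)
  have hl' : 0 < |l| := abs_pos.2 hl
  simp only [yosidaContraction, smul_apply, sub_apply,
    norm_smul, norm_div, Complex.norm_mul, norm_I, norm_real, Real.norm_eq_abs, one_mul,
    RCLike.norm_ofNat]
  calc |l| / 2 * _ ≤ |l| / 2 * (|l|⁻¹ * ‖y‖ + |l|⁻¹ * ‖y‖) := by gcongr; linarith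
    _ = ‖y‖ := by field_simp; ring

/-- On the domain the error equals minus the mean of the two resolvents applied to Ax, each of size
at most ‖Ax‖/|l|. -/
lemma norm_yosidaContraction_sub_le (hA : IsSelfAdjoint A) {l : ℝ} (hl : l ≠ 0) {x y : E}
    (h : (x, y) ∈ A.graph) : ‖yosidaContraction hA hl x - x‖ ≤ |l|⁻¹ * ‖y‖ := by
  have h1 := resolventI_apply hA hl h
  have h2 := resolventI_apply hA (neg_ne_zero.2 hl) h
  rw [map_add, map_smul] at h1 h2
  have b1 := norm_resolventI_apply_le hA hl y
  have b2 := norm_resolventI_apply_le hA (neg_ne_zero.2 hl) y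
  rw [abs_neg] at b2
  have h3 := norm_add_le (resolventI hA hl y) (resolventI hA (neg_ne_zero.2 hl) y)
  have e : yosidaContraction hA hl x - x =
      (-(1 / 2) : ℂ) • (resolventI hA hl y + resolventI hA (neg_ne_zero.2 hl) y) := by
    rw [eq_sub_of_add_eq h1, eq_sub_of_add_eq h2]
    simp only [yosidaContraction, smul_apply, sub_apply,
      ofReal_neg]
    module
  rw [e, norm_smul]
  norm_num
  linarith

/-- The adjoint of the resolvent at l is the resolvent at −l, so their sum is symmetric. -/
lemma isSelfAdjoint_yosida (hA : IsSelfAdjoint A) {l : ℝ} (hl : l ≠ 0) (x y : E) :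
    (inner ℂ (yosida hA hl x) y : ℂ) = inner ℂ x (yosida hA hl y) := by
  have h1 := resolventI_inner hA hl (neg_ne_zero.2 hl) x y
  have h2 := resolventI_inner hA hl (neg_ne_zero.2 hl) y x
  rw [← inner_conj_symm, ← inner_conj_symm y] at h2
  have h2' := (starRingEnd ℂ).injective h2
  simp only [yosida, smul_apply, add_apply,
    inner_smul_left, inner_smul_right, inner_add_left, inner_add_right, h1, ← h2']
  simp only [map_div₀, map_pow, conj_ofReal, map_ofNat]
  ring

lemma commute_yosida (hA : IsSelfAdjoint A) {l m : ℝ} (hl : l ≠ 0) (hm : m ≠ 0) :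
    Commute (yosida hA hl) (yosida hA hm) := by
  refine Commute.smul_left (Commute.smul_right ?_ _) _
  exact Commute.add_left
    ((commute_resolventI hA _ _).add_right (commute_resolventI hA _ _))
    ((commute_resolventI hA _ _).add_right (commute_resolventI hA _ _))

lemma smul_yosida_mem_skewAdjoint (hA : IsSelfAdjoint A) {l : ℝ} (hl : l ≠ 0) {c : ℂ}
    (hc : conj c = -c) : c • yosida hA hl ∈ skewAdjoint (E →L[ℂ] E) := by
  rw [skewAdjoint.mem_iff, ContinuousLinearMap.star_eq_adjoint, eq_comm,
    ContinuousLinearMap.eq_adjoint_iff]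
  intro x y
  rw [neg_apply, smul_apply,
    smul_apply, inner_neg_left, inner_smul_left, inner_smul_right, hc,
    isSelfAdjoint_yosida]
  ring

end Resolvent

/-! ### Stone's theorem -/

section Stone

open Filter Topology Complex

variable {E : Type u} [NormedAddCommGroup E] [InnerProductSpace ℂ E] [CompleteSpace E]
  {A : E →ₗ.[ℂ] E}

omit [CompleteSpace E] in
lemma dense_image_fst_graph (hA : Dense (A.domain : Set E)) :
    Dense (Prod.fst '' (A.graph : Set (E × E))) := by
  refine hA.mono fun x hx => ?_
  exact ⟨_, LinearPMap.mem_graph A ⟨x, hx⟩, rfl⟩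

lemma tendsto_yosidaContraction (hA : IsSelfAdjoint A) (y : E) :
    Tendsto (fun n : ℕ => yosidaContraction hA (Nat.cast_add_one_ne_zero (R := ℝ) n) y) atTop
      (𝓝 y) := by
  refine (isClosed_setOf_tendsto (f := fun n : ℕ =>
    yosidaContraction hA (Nat.cast_add_one_ne_zero (R := ℝ) n)) fun n x y => ?_).closure_subset_iff.2
      ?_ (dense_image_fst_graph hA.dense_domain y)
  · rw [← map_sub]
    exact norm_yosidaContraction_apply_le hA _ _
  · rintro _ ⟨⟨x, y⟩, hp, rfl⟩
    refine tendsto_iff_norm_sub_tendsto_zero.2 ?_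
    refine squeeze_zero (fun n => norm_nonneg _)
      (fun n => norm_yosidaContraction_sub_le hA _ hp) ?_
    have h := (tendsto_one_div_add_atTop_nhds_zero_nat (𝕜 := ℝ)).mul_const ‖y‖
    rw [zero_mul] at h
    refine h.congr fun n => ?_
    rw [abs_of_pos (by positivity), one_div]

/-- A skew-adjoint operator `c A`, where `A` is self-adjoint, generates a unitary group. -/
lemma exists_isUnitaryGroup (hA : IsSelfAdjoint A) {c : ℂ} (hc : conj c = -c) :
    ∃ U : ℝ → (E ≃ₗᵢ[ℂ] E), IsUnitaryGroup U ∧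
      ∀ x y, (x, y) ∈ A.graph → HasDerivAt (fun t => U t x) (c • y) 0 := by
  -- The parameter l = n + 1 is never zero and tends to infinity.
  let hn : ∀ n : ℕ, (n : ℝ) + 1 ≠ 0 := fun n => Nat.cast_add_one_ne_zero (R := ℝ) n
  let hX : ∀ n : ℕ, c • yosida hA (hn n) ∈ skewAdjoint (E →L[ℂ] E) := fun n =>
    smul_yosida_mem_skewAdjoint hA (hn n) hc
  let V : ℕ → ℝ → (E ≃ₗᵢ[ℂ] E) := fun n => expGroup (hX n)
  have hV : ∀ n, IsUnitaryGroup (V n) := fun n => isUnitaryGroup_expGroup (hX n)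
  have hXt : ∀ x y, (x, y) ∈ A.graph →
      Tendsto (fun n => (c • yosida hA (hn n)) x) atTop (𝓝 (c • y)) := by
    intro x y h
    refine ((tendsto_yosidaContraction hA y).const_smul c).congr fun n => ?_
    rw [smul_apply, yosida_apply_of_mem_graph hA (hn n) h]
  have hcauchy : ∀ t x, CauchySeq fun n => V n t x := by
    intro t x
    refine (isClosed_setOf_cauchySeq (f := fun n => V n t) fun n x y => ?_).closure_subset_iff.2 ?_
      (dense_image_fst_graph hA.dense_domain x)
    · rw [← map_sub, LinearIsometryEquiv.norm_map]
    · rintro _ ⟨⟨x, y⟩, hp, rfl⟩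
      refine Metric.cauchySeq_iff.2 fun ε hε => ?_
      -- The two groups differ at `x` by at most |t| times the difference of their generators at
      -- `x`; the extra `1` keeps the denominator positive at t = 0.
      obtain ⟨N, hN⟩ := Metric.cauchySeq_iff.1 (hXt x y hp).cauchySeq (ε / (|t| + 1))
        (by positivity)
      refine ⟨N, fun m hm n hn' => ?_⟩
      have h1 := norm_expGroup_sub_expGroup_le (hX n) (hX m)
        (((commute_yosida hA (hn n) (hn m)).smul_left c).smul_right c) t x
      have h2 := hN m hm n hn'
      rw [dist_eq_norm, lt_div_iff₀ (by positivity)] at h2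
      rw [dist_eq_norm]
      refine h1.trans_lt (lt_of_le_of_lt ?_ h2)
      rw [mul_comm]
      gcongr
      linarith
  obtain ⟨U, hadd, hU⟩ := exists_limit_group hV hcauchy
  have hbound : ∀ n x y, (x, y) ∈ A.graph → ‖(c • yosida hA (hn n)) x‖ ≤ ‖c‖ * ‖y‖ := by
    intro n x y h
    rw [smul_apply, yosida_apply_of_mem_graph hA (hn n) h, norm_smul]
    gcongr
    exact norm_yosidaContraction_apply_le hA _ _
  have hcont : ∀ x, Continuous fun t => U t x := by
    intro x
    refine isClosed_setOf_continuous_orbit.closure_subset_iff.2 ?_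
      (dense_image_fst_graph hA.dense_domain x)
    rintro _ ⟨⟨x, y⟩, hp, rfl⟩
    -- On the domain the approximating orbits are Lipschitz with a constant independent of n, and
    -- the bound passes to the limit.
    refine (LipschitzWith.of_dist_le_mul (K := ⟨‖c‖ * ‖y‖, by positivity⟩) fun s t => ?_).continuous
    refine le_of_tendsto ((hU s x).dist (hU t x)) (Eventually.of_forall fun n => ?_)
    have h1 : V n s x = V n t (V n (s - t) x) := by rw [← (hV n).add, add_sub_cancel]
    rw [h1, LinearIsometryEquiv.dist_map, dist_eq_norm]
    refine (norm_expGroup_sub_le (hX n) (s - t) x).trans ?_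
    rw [Real.dist_eq, mul_comm]
    change _ ≤ ‖c‖ * ‖y‖ * |s - t|
    gcongr
    exact hbound n x y hp
  have hUg : IsUnitaryGroup U := ⟨hadd, hcont⟩
  refine ⟨U, hUg, fun x y h => hUg.hasDerivAt_iff.2 fun t => ?_⟩
  have h1 : ∀ n, V n t x - x = ∫ s in (0 : ℝ)..t, V n s ((c • yosida hA (hn n)) x) := fun n =>
    (hV n).hasDerivAt_iff.1 (hasDerivAt_expGroup_zero (hX n) x) t
  -- The integrated equation of each approximating group passes to the limit by dominated
  -- convergence, with the constant bound ‖c‖‖y‖.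
  refine tendsto_nhds_unique ((hU t x).sub_const x) ?_
  simp only [h1, hUg.integral_apply]
  refine intervalIntegral.tendsto_integral_filter_of_dominated_convergence (fun _ => ‖c‖ * ‖y‖)
    ?_ ?_ intervalIntegrable_const ?_
  · exact Eventually.of_forall fun n => ((hV n).continuous _).aestronglyMeasurable
  · refine Eventually.of_forall fun n => Eventually.of_forall fun s _ => ?_
    rw [LinearIsometryEquiv.norm_map]
    exact hbound n x y h
  · refine Eventually.of_forall fun s _ => ?_
    refine tendsto_of_tendsto_of_dist (hU s (c • y)) ?_
    simp only [LinearIsometryEquiv.dist_map]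
    simpa only [dist_comm] using tendsto_iff_dist_tendsto_zero.1 (hXt x y h)

/-- Stone's theorem: a self-adjoint operator generates a strongly continuous unitary group. -/
lemma exists_isEvolutionGroup {ħ : ℝ} (hħ : ħ ≠ 0) (hA : IsSelfAdjoint A) :
    ∃ U : ℝ → (E ≃ₗᵢ[ℂ] E), IsEvolutionGroup ħ A U := by
  have hc : conj (-(I / (ħ : ℂ))) = -(-(I / (ħ : ℂ))) := by
    simp [neg_div]
  have hc0 : -(I / (ħ : ℂ)) ≠ 0 := by
    simp [hħ]
  obtain ⟨U, hU, hgen⟩ := exists_isUnitaryGroup hA hc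
  refine ⟨U, hU.add, hU.continuous, fun x y => ⟨hgen x y, fun h => ?_⟩⟩
  refine (mem_graph_iff_of_isSelfAdjoint hA).2 fun a b hab => ?_
  -- The generator has no more than A: differentiating the constant ⟪U(t)a, U(t)x⟫ at 0 gives the
  -- symmetry relation that puts (x, y) in the graph of A.
  have h1 := (hgen a b hab).inner ℂ h
  simp only [LinearIsometryEquiv.inner_map_map, hU.zero_apply] at h1
  have h2 := h1.unique (hasDerivAt_const (0 : ℝ) (inner ℂ a x : ℂ))
  rw [inner_smul_left, inner_smul_right, hc] at h2
  refine mul_left_cancel₀ hc0 ?_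
  linear_combination -h2

/-- Only the defining properties of the chosen group are used below; its uniqueness is never needed.
-/
lemma isEvolutionGroup_evolution {ħ : ℝ} (hħ : ħ ≠ 0) (hA : IsSelfAdjoint A) :
    IsEvolutionGroup ħ A (evolution ħ A) := by
  rw [evolution, dif_pos (exists_isEvolutionGroup hħ hA)]
  exact (exists_isEvolutionGroup hħ hA).choose_spec

end Stone

/-! ### Multiplication by operator-valued functions and translations on `L²(ℝ; E)` -/

section VectorValued

open Filter Topology

variable {E : Type u} {F : Type v}
  [NormedAddCommGroup E] [InnerProductSpace ℂ E]
  [NormedAddCommGroup F] [InnerProductSpace ℂ F]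

/-- The Hilbert space `L²(ℝ; E)`. -/
abbrev L2 (E : Type u) [NormedAddCommGroup E] : Type u := Lp E 2 (volume : Measure ℝ)

lemma memLp_mul {W : ℝ → E →ₗᵢ[ℂ] F} (hW : Continuous fun p : ℝ × E => W p.1 p.2)
    {f : ℝ → E} (hf : MemLp f 2 (volume : Measure ℝ)) :
    MemLp (fun t => W t (f t)) 2 (volume : Measure ℝ) := by
  have hm : AEStronglyMeasurable (fun t => W t (f t)) (volume : Measure ℝ) :=
    hW.comp_aestronglyMeasurable (aestronglyMeasurable_id.prodMk hf.aestronglyMeasurable)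
  refine (memLp_congr_norm hm hf.aestronglyMeasurable (Eventually.of_forall fun t => ?_)).2 hf
  exact (W t).norm_map _

/-- Multiplication by a strongly continuous function with isometric values. -/
def mulIsometry (W : ℝ → E →ₗᵢ[ℂ] F) (hW : Continuous fun p : ℝ × E => W p.1 p.2) :
    L2 E →ₗᵢ[ℂ] L2 F where
  toFun f := (memLp_mul hW (Lp.memLp f)).toLp _
  map_add' f g := by
    rw [← MemLp.toLp_add, MemLp.toLp_eq_toLp_iff]
    filter_upwards [Lp.coeFn_add f g] with t ht
    rw [ht, Pi.add_apply, Pi.add_apply, map_add]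
  map_smul' c f := by
    rw [RingHom.id_apply, ← MemLp.toLp_const_smul, MemLp.toLp_eq_toLp_iff]
    filter_upwards [Lp.coeFn_smul c f] with t ht
    rw [ht, Pi.smul_apply, Pi.smul_apply, map_smul]
  norm_map' f := by
    change ‖(memLp_mul hW (Lp.memLp f)).toLp _‖ = ‖f‖
    rw [Lp.norm_toLp, Lp.norm_def]
    congr 1
    exact eLpNorm_congr_norm_ae (Eventually.of_forall fun t => (W t).norm_map _)

lemma coeFn_mulIsometry (W : ℝ → E →ₗᵢ[ℂ] F) (hW : Continuous fun p : ℝ × E => W p.1 p.2)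
    (f : L2 E) : mulIsometry W hW f =ᵐ[volume] fun t => W t (f t) :=
  (memLp_mul hW (Lp.memLp f)).coeFn_toLp

/-- Multiplication by a strongly continuous function with unitary values. -/
def mulUnitary (W : ℝ → E ≃ₗᵢ[ℂ] F) (hW : Continuous fun p : ℝ × E => W p.1 p.2)
    (hW' : Continuous fun p : ℝ × F => (W p.1).symm p.2) : L2 E ≃ₗᵢ[ℂ] L2 F where
  toLinearEquiv := LinearEquiv.ofLinearMap
    (mulIsometry (fun t => (W t).toLinearIsometry) hW).toLinearMap
    (mulIsometry (fun t => (W t).symm.toLinearIsometry) hW').toLinearMap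
    (by
      refine LinearMap.ext fun f => Lp.ext ?_
      refine (coeFn_mulIsometry (fun t => (W t).toLinearIsometry) hW _).trans ?_
      filter_upwards [coeFn_mulIsometry (fun t => (W t).symm.toLinearIsometry) hW' f] with t ht
      exact (congrArg (W t) ht).trans ((W t).apply_symm_apply _))
    (by
      refine LinearMap.ext fun f => Lp.ext ?_
      refine (coeFn_mulIsometry (fun t => (W t).symm.toLinearIsometry) hW' _).trans ?_
      filter_upwards [coeFn_mulIsometry (fun t => (W t).toLinearIsometry) hW f] with t ht
      exact (congrArg (W t).symm ht).trans ((W t).symm_apply_apply _))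
  norm_map' := (mulIsometry (fun t => (W t).toLinearIsometry) hW).norm_map

lemma coeFn_mulUnitary (W : ℝ → E ≃ₗᵢ[ℂ] F) (hW : Continuous fun p : ℝ × E => W p.1 p.2)
    (hW' : Continuous fun p : ℝ × F => (W p.1).symm p.2) (f : L2 E) :
    mulUnitary W hW hW' f =ᵐ[volume] fun t => W t (f t) :=
  coeFn_mulIsometry (fun t => (W t).toLinearIsometry) hW f

lemma ae_sub_right {p : ℝ → Prop} (h : ∀ᵐ t : ℝ, p t) (s : ℝ) : ∀ᵐ t : ℝ, p (t - s) :=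
  (measurePreserving_sub_right volume s).quasiMeasurePreserving.ae h

/-- Translation by `s`, as an isometry of `L²(ℝ; E)`. -/
def translationIsometry (E : Type u) [NormedAddCommGroup E] [InnerProductSpace ℂ E] (s : ℝ) :
    L2 E →ₗᵢ[ℂ] L2 E :=
  Lp.compMeasurePreservingₗᵢ ℂ (fun t => t - s) (measurePreserving_sub_right volume s)

lemma coeFn_translationIsometry (s : ℝ) (f : L2 E) :
    translationIsometry E s f =ᵐ[volume] fun t => f (t - s) :=
  Lp.coeFn_compMeasurePreserving f (measurePreserving_sub_right volume s)

/-- The translation group of `L²(ℝ; E)`. -/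
def translation (E : Type u) [NormedAddCommGroup E] [InnerProductSpace ℂ E] :
    ℝ → (L2 E ≃ₗᵢ[ℂ] L2 E) :=
  unitaryFamily (translationIsometry E)
    (fun f => Lp.ext (by simpa using coeFn_translationIsometry 0 f))
    (fun s t f => Lp.ext (by
      refine (coeFn_translationIsometry _ f).trans ?_
      refine EventuallyEq.trans ?_ (coeFn_translationIsometry s _).symm
      filter_upwards [ae_sub_right (coeFn_translationIsometry t f) s] with r hr
      rw [hr, sub_sub]))

lemma coeFn_translation (s : ℝ) (f : L2 E) :
    translation E s f =ᵐ[volume] fun t => f (t - s) :=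
  coeFn_translationIsometry s f

lemma isUnitaryGroup_translation : IsUnitaryGroup (translation E) where
  add s t f := Lp.ext (by
      refine (coeFn_translation _ f).trans ?_
      refine EventuallyEq.trans ?_ (coeFn_translation s _).symm
      filter_upwards [ae_sub_right (coeFn_translation t f) s] with r hr
      rw [hr, sub_sub])
  continuous f := by
    let g : ℝ → C(ℝ, ℝ) := fun s => ⟨fun t => t - s, by fun_prop⟩
    have hg : Continuous g := ContinuousMap.continuous_of_continuous_uncurry _
      (by change Continuous fun p : ℝ × ℝ => p.2 - p.1; fun_prop)
    exact Continuous.compMeasurePreservingLp (f := fun _ : ℝ => f) continuous_const hg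
      (fun s => measurePreserving_sub_right volume s) (by norm_num)

end VectorValued

/-! ### The weak derivative and the translation group -/

section WeakDerivative

open Filter Topology

lemma integral_smul_translation (φ : ℝ → ℝ) (s : ℝ) (f : L2R) :
    ∫ t, φ t • (translation ℂ s f : ℝ → ℂ) t = ∫ t, φ (t + s) • (f : ℝ → ℂ) t := by
  have h1 : ∫ t, φ t • (translation ℂ s f : ℝ → ℂ) t = ∫ t, φ t • (f : ℝ → ℂ) (t - s) := by
    refine integral_congr_ae ?_
    filter_upwards [coeFn_translation s f] with t ht
    rw [ht]
  rw [h1, ← integral_sub_right_eq_self (fun t => φ (t + s) • (f : ℝ → ℂ) t) s]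
  simp only [sub_add_cancel]

/-- The translation is moved onto the test function, which stays a test function. -/
lemma translation_mem_weakDerivGraph {f g : L2R} (h : (f, g) ∈ weakDerivGraph) (s : ℝ) :
    (translation ℂ s f, translation ℂ s g) ∈ weakDerivGraph := by
  intro φ hφ hc
  have hc' : HasCompactSupport fun t => φ (t + s) :=
    hc.comp_homeomorph (Homeomorph.addRight s)
  have h1 := h (fun t => φ (t + s)) (hφ.comp (contDiff_id.add contDiff_const)) hc'
  simp only [deriv_comp_add_const] at h1
  change ∫ t, deriv φ t • (translation ℂ s f : ℝ → ℂ) t = - ∫ t, φ t • (translation ℂ s g) t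
  rw [integral_smul_translation, integral_smul_translation]
  exact h1

/-- Smooth compactly supported functions are dense in L² and, by integration by parts, have their
classical derivative as weak derivative. -/
lemma dense_image_fst_weakDerivGraph :
    Dense (Prod.fst '' (weakDerivGraph : Set (L2R × L2R))) := by
  refine (Lp.dense_hasCompactSupport_contDiff (E := ℝ) (F := ℂ) (μ := (volume : Measure ℝ))
    (p := 2) (by norm_num)).mono ?_
  rintro f ⟨φ, hfφ, hc, hφ⟩
  have hd : Continuous (deriv φ) := hφ.continuous_deriv (by simp)
  have hdm : MemLp (deriv φ) 2 (volume : Measure ℝ) := hd.memLp_of_hasCompactSupport hc.deriv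
  refine ⟨(f, hdm.toLp), fun χ hχ hχc => ?_, rfl⟩
  have hχd : Continuous (deriv χ) := hχ.continuous_deriv (by simp)
  have e1 : ∫ t, deriv χ t • (f : ℝ → ℂ) t = ∫ t, deriv χ t • φ t := by
    refine integral_congr_ae ?_
    filter_upwards [hfφ] with t ht
    rw [ht]
  have e2 : ∫ t, χ t • (hdm.toLp : ℝ → ℂ) t = ∫ t, χ t • deriv φ t := by
    refine integral_congr_ae ?_
    filter_upwards [hdm.coeFn_toLp] with t ht
    rw [ht]
  have e3 := integral_bilinear_hasDerivAt_right_eq_neg_left_of_integrable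
    (L := ContinuousLinearMap.lsmul ℝ ℝ) (u := χ) (v := φ) (u' := deriv χ) (v' := deriv φ)
    (fun t _ => ((hχ.differentiable (by simp)) t).hasDerivAt)
    (fun t _ => ((hφ.differentiable (by simp)) t).hasDerivAt)
    ((hχ.continuous.smul hd).integrable_of_hasCompactSupport hχc.smul_right)
    ((hχd.smul hφ.continuous).integrable_of_hasCompactSupport hχc.deriv.smul_right)
    ((hχ.continuous.smul hφ.continuous).integrable_of_hasCompactSupport hχc.smul_right)
  simp only [ContinuousLinearMap.lsmul_apply] at e3
  change ∫ t, deriv χ t • (f : ℝ → ℂ) t = - ∫ t, χ t • (hdm.toLp : ℝ → ℂ) t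
  rw [e1, e2, e3, neg_neg]

/-- The functional `f ↦ ∫ φ f` on `L²(ℝ)`, for a real test function `φ`. -/
lemma exists_testFunctional {φ : ℝ → ℝ} (hφ : Continuous φ) (hc : HasCompactSupport φ) :
    ∃ ℓ : L2R →L[ℂ] ℂ, ∀ f : L2R, ℓ f = ∫ t, φ t • (f : ℝ → ℂ) t := by
  have hm : MemLp (fun t => (φ t : ℂ)) 2 (volume : Measure ℝ) :=
    (Complex.continuous_ofReal.comp hφ).memLp_of_hasCompactSupport
      (hc.comp_left (g := ((↑) : ℝ → ℂ)) Complex.ofReal_zero)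
  refine ⟨innerSL ℂ hm.toLp, fun f => ?_⟩
  rw [innerSL_apply_apply, L2.inner_def]
  refine integral_congr_ae ?_
  filter_upwards [hm.coeFn_toLp] with t ht
  rw [ht]
  simp [mul_comm]

/-- The integral is the convolution of f with t ↦ φ(−t), evaluated at −s. Differentiation falls on
the smooth factor, and the weak derivative then moves it to f. -/
lemma hasDerivAt_integral_shift {f g : L2R} (h : (f, g) ∈ weakDerivGraph) {φ : ℝ → ℝ}
    (hφ : ContDiff ℝ ∞ φ) (hc : HasCompactSupport φ) (s : ℝ) :
    HasDerivAt (fun s => ∫ t, φ (t + s) • (f : ℝ → ℂ) t)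
      (-∫ t, φ (t + s) • (g : ℝ → ℂ) t) s := by
  have hf : LocallyIntegrable (f : ℝ → ℂ) volume :=
    (Lp.memLp f).locallyIntegrable (by norm_num)
  have hψc : HasCompactSupport fun t => φ (-t) := hc.comp_homeomorph (Homeomorph.neg ℝ)
  have hψ : ContDiff ℝ ∞ fun t => φ (-t) := hφ.comp contDiff_neg
  have h1 := hψc.hasDerivAt_convolution_right (ContinuousLinearMap.lsmul ℝ ℝ).flip hf
    (hψ.of_le (by simp)) (-s)
  have h2 := h1.scomp s (hasDerivAt_neg s)
  have h3 := h (fun t => φ (t + s)) (hφ.comp (contDiff_id.add contDiff_const))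
    (hc.comp_homeomorph (Homeomorph.addRight s))
  simp only [deriv_comp_add_const] at h3
  refine (h2.congr_of_eventuallyEq (Eventually.of_forall fun r => ?_)).congr_deriv ?_
  · simp only [Function.comp, convolution_def, ContinuousLinearMap.flip_apply,
      ContinuousLinearMap.lsmul_apply]
    congr 1
    funext t
    congr 2
    ring
  · rw [← h3, convolution_def, neg_smul, one_smul, ← integral_neg]
    congr 1
    funext t
    rw [deriv_comp_neg, ContinuousLinearMap.flip_apply, ContinuousLinearMap.lsmul_apply, neg_smul,
      neg_neg]
    congr 2
    ring

/-- If `g` is the weak derivative of `f`, then the translates of `f` have derivative `-g`. -/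
lemma hasDerivAt_translation {f g : L2R} (h : (f, g) ∈ weakDerivGraph) :
    HasDerivAt (fun s => translation ℂ s f) (-g) 0 := by
  have hT : IsUnitaryGroup (translation ℂ) := isUnitaryGroup_translation
  refine hT.hasDerivAt_iff.2 fun s => ?_
  rw [← sub_eq_zero, Lp.eq_zero_iff_ae_eq_zero]
  -- The integrated equation is tested against each φ, where it becomes the fundamental theorem of
  -- calculus for a scalar function. Weak information thus yields a strong derivative.
  refine ae_eq_zero_of_integral_contDiff_smul_eq_zero
    ((Lp.memLp _).locallyIntegrable (by norm_num)) fun φ hφ hc => ?_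
  obtain ⟨ℓ, hℓ⟩ := exists_testFunctional hφ.continuous hc
  have e1 : ∀ r, HasDerivAt (fun r => ℓ (translation ℂ r f)) (ℓ (translation ℂ r (-g))) r := by
    intro r
    rw [map_neg, map_neg]
    simp only [hℓ, integral_smul_translation]
    exact hasDerivAt_integral_shift h hφ hc r
  have e2 := intervalIntegral.integral_eq_sub_of_hasDerivAt (a := 0) (b := s) (fun r _ => e1 r)
    ((ℓ.continuous.comp (hT.continuous (-g))).intervalIntegrable _ _)
  have e3 : ∫ r in (0 : ℝ)..s, ℓ (translation ℂ r (-g)) = ℓ (hT.integral s (-g)) :=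
    ℓ.intervalIntegral_comp_comm ((hT.continuous (-g)).intervalIntegrable _ _)
  rw [← hℓ, map_sub, map_sub, ← e3, e2, hT.zero_apply, sub_self]

end WeakDerivative

/-! ### Generators on tensor products -/

section TensorGenerator

open Filter Topology

variable {K : Type u} {E : Type v}
  [NormedAddCommGroup K] [InnerProductSpace ℂ K]
  [NormedAddCommGroup E] [InnerProductSpace ℂ E]

/-- The elementary tensor as a continuous bilinear map. -/
def pureTensorL (K : Type u) (E : Type v) [NormedAddCommGroup K] [InnerProductSpace ℂ K]
    [NormedAddCommGroup E] [InnerProductSpace ℂ E] : K →L[ℂ] E →L[ℂ] HilbertTensor K E :=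
  (ContinuousLinearMap.compL ℂ E (K ⊗[ℂ] E) (HilbertTensor K E)
    UniformSpace.Completion.toComplL).comp (TensorProduct.mkL ℂ K E)

lemma pureTensorL_apply (x : K) (y : E) : pureTensorL K E x y = pureTensor x y := rfl

lemma hilbertTensor_induction {p : HilbertTensor K E → Prop} (hcl : IsClosed {z | p z})
    (h0 : p 0) (hpure : ∀ x y, p (pureTensor x y)) (hadd : ∀ z w, p z → p w → p (z + w))
    (z : HilbertTensor K E) : p z := by
  refine UniformSpace.Completion.induction_on z hcl fun a => ?_
  induction a using TensorProduct.induction_on with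
  | zero => rw [UniformSpace.Completion.coe_zero]; exact h0
  | tmul x y => exact hpure x y
  | add a b ha hb => rw [UniformSpace.Completion.coe_add]; exact hadd _ _ ha hb

/-- If `T` and `U` are unitary groups whose generators extend `c A` and are `c B`, then the
generator of `T ⊗ U` is `c (A ⊗ I + I ⊗ B)`, provided the domains are dense and invariant. -/
lemma mem_tensorSumGraph_iff {c : ℂ} (hc : c ≠ 0) {A : K →ₗ.[ℂ] K} {B : E →ₗ.[ℂ] E}
    {T : ℝ → (K ≃ₗᵢ[ℂ] K)} {U : ℝ → (E ≃ₗᵢ[ℂ] E)}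
    {G : ℝ → (HilbertTensor K E ≃ₗᵢ[ℂ] HilbertTensor K E)}
    (hT : IsUnitaryGroup T) (hU : IsUnitaryGroup U) (hG : IsUnitaryGroup G)
    (hTUG : ∀ s x y, G s (pureTensor x y) = pureTensor (T s x) (U s y))
    (hA : Dense (A.domain : Set K)) (hB : Dense (B.domain : Set E))
    (hTA : ∀ x y, (x, y) ∈ A.graph → HasDerivAt (fun t => T t x) (c • y) 0)
    (hUB : ∀ x y, (x, y) ∈ B.graph → HasDerivAt (fun t => U t x) (c • y) 0)
    (hTi : ∀ x y, (x, y) ∈ A.graph → ∀ s, (T s x, T s y) ∈ A.graph)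
    (hUi : ∀ x y, (x, y) ∈ B.graph → ∀ s, (U s x, U s y) ∈ B.graph)
    {x y : HilbertTensor K E} :
    (x, y) ∈ tensorSumGraph A B ↔ HasDerivAt (fun t => G t x) (c • y) 0 := by
  set S : Set (HilbertTensor K E × HilbertTensor K E) := Set.range fun p : A.domain × B.domain =>
    (pureTensor (p.1 : K) (p.2 : E), pureTensor (A p.1) (p.2 : E) + pureTensor (p.1 : K) (B p.2))
    with hS
  have hdef : tensorSumGraph A B = (Submodule.span ℂ S).topologicalClosure := rfl
  have hcl : IsClosed (tensorSumGraph A B : Set (HilbertTensor K E × HilbertTensor K E)) :=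
    Submodule.isClosed_topologicalClosure _
  have hsub : S ⊆ tensorSumGraph A B :=
    Submodule.subset_span.trans (Submodule.le_topologicalClosure _)
  -- On elementary tensors this is the product rule; linearity and closedness of the generator
  -- extend it to the closure.
  have hgen : ∀ p ∈ tensorSumGraph A B, HasDerivAt (fun t => G t p.1) (c • p.2) 0 := by
    intro p hp
    refine closure_minimal (fun r hr => ?_) (hG.isClosed_generator c) hp
    induction hr using Submodule.span_induction with
    | mem r hr =>
      obtain ⟨⟨a, b⟩, rfl⟩ := hr
      simp only [Set.mem_ofPred_eq, hTUG]
      have ha := hTA _ _ (LinearPMap.mem_graph A a)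
      have hb := hUB _ _ (LinearPMap.mem_graph B b)
      have h := ((pureTensorL K E).bilinearRestrictScalars ℝ).hasFDerivAt_of_bilinear
        ha.hasFDerivAt hb.hasFDerivAt
      have h' := h.hasDerivAt
      refine h'.congr_deriv ?_
      simp [hT.zero_apply, hU.zero_apply, pureTensorL_apply, add_comm]
    | zero => simpa using hasDerivAt_const (0 : ℝ) (0 : HilbertTensor K E)
    | add a b _ _ ha hb =>
      simp only [Set.mem_ofPred_eq] at ha hb ⊢
      simp only [Prod.fst_add, Prod.snd_add, map_add, smul_add]
      exact ha.add hb
    | smul d a _ ha =>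
      simp only [Set.mem_ofPred_eq] at ha ⊢
      have h := ha.const_smul d
      simp only [Prod.smul_fst, Prod.smul_snd, map_smul]
      rw [smul_comm c d]
      exact h
  -- The converse is the core criterion: the remaining goals are invariance under G and density of
  -- the domain, both inherited from the two factors.
  refine ⟨hgen (x, y), hG.mem_of_hasDerivAt hc _ hcl hgen ?_ ?_⟩
  · intro p hp s
    have hcl' : IsClosed {p : HilbertTensor K E × HilbertTensor K E |
        (G s p.1, G s p.2) ∈ (tensorSumGraph A B : Set _)} :=
      hcl.preimage (((G s).continuous.comp continuous_fst).prodMk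
        ((G s).continuous.comp continuous_snd))
    refine closure_minimal (fun r hr => ?_) hcl' hp
    induction hr using Submodule.span_induction with
    | mem r hr =>
      obtain ⟨⟨a, b⟩, rfl⟩ := hr
      obtain ⟨a', ha1, ha2⟩ := LinearPMap.mem_graph_iff _ |>.1
        (hTi _ _ (LinearPMap.mem_graph A a) s)
      obtain ⟨b', hb1, hb2⟩ := LinearPMap.mem_graph_iff _ |>.1
        (hUi _ _ (LinearPMap.mem_graph B b) s)
      refine hsub ⟨(a', b'), ?_⟩
      simp only at ha1 ha2 hb1 hb2
      simp only [hTUG, map_add, ha1, ha2, hb1, hb2]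
    | zero =>
      simp only [Set.mem_ofPred_eq, Prod.fst_zero, Prod.snd_zero, map_zero]
      exact (tensorSumGraph A B).zero_mem
    | add a b _ _ ha hb =>
      simp only [Set.mem_ofPred_eq, Prod.fst_add, Prod.snd_add, map_add] at ha hb ⊢
      exact (tensorSumGraph A B).add_mem ha hb
    | smul d a _ ha =>
      simp only [Set.mem_ofPred_eq, Prod.smul_fst, Prod.smul_snd, map_smul] at ha ⊢
      exact (tensorSumGraph A B).smul_mem d ha
  · let D : Submodule ℂ (HilbertTensor K E) :=
      (tensorSumGraph A B).map (LinearMap.fst ℂ (HilbertTensor K E) (HilbertTensor K E))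
    have hD : D.topologicalClosure = ⊤ := by
      refine Submodule.eq_top_iff'.2 fun z => ?_
      refine hilbertTensor_induction (p := fun z => z ∈ D.topologicalClosure)
        (Submodule.isClosed_topologicalClosure D) D.topologicalClosure.zero_mem ?_
        (fun _ _ => D.topologicalClosure.add_mem) z
      intro a b
      have hcl' : IsClosed {w : K × E | pureTensor w.1 w.2 ∈ (D.topologicalClosure : Set _)} := by
        refine (Submodule.isClosed_topologicalClosure D).preimage ?_
        exact (UniformSpace.Completion.continuous_coe _).comp TensorProduct.continuous_tmul
      refine closure_minimal (fun w hw => ?_) hcl' ((hA.prod hB) (a, b))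
      exact D.le_topologicalClosure ⟨_, hsub ⟨(⟨w.1, hw.1⟩, ⟨w.2, hw.2⟩), rfl⟩, rfl⟩
    exact (Submodule.dense_iff_topologicalClosure_eq_top (s := D)).2 hD

end TensorGenerator

/-! ### The identification of `K ⊗ E` with `L²(ℝ; E)` -/

section Wave

open Filter Topology

variable {K : Type u} {E : Type v}
  [NormedAddCommGroup K] [InnerProductSpace ℂ K]
  [NormedAddCommGroup E] [InnerProductSpace ℂ E]

/-- The bilinear map `(x, χ) ↦ (t ↦ x(t) χ)`, where `x(t)` is the time representation of `x`. -/
def waveBilinear (e : K ≃ₗᵢ[ℂ] L2R) : K →ₗ[ℂ] E →ₗ[ℂ] L2 E :=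
  ((ContinuousLinearMap.lsmul ℂ ℂ : ℂ →L[ℂ] E →L[ℂ] E).flip.compLpₗ₂ 2
    (volume : Measure ℝ)).flip.comp e.toLinearEquiv.toLinearMap

lemma coeFn_waveBilinear (e : K ≃ₗᵢ[ℂ] L2R) (x : K) (χ : E) :
    waveBilinear e x χ =ᵐ[volume] fun t => (e x : ℝ → ℂ) t • χ :=
  ContinuousLinearMap.coeFn_compLp _ _

lemma inner_waveBilinear (e : K ≃ₗᵢ[ℂ] L2R) (x : K) (χ : E) (F : L2 E) :
    (inner ℂ (waveBilinear e x χ) F : ℂ) =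
      ∫ t, conj ((e x : ℝ → ℂ) t) * inner ℂ χ (F t) := by
  rw [L2.inner_def]
  refine integral_congr_ae ?_
  filter_upwards [coeFn_waveBilinear e x χ] with t ht
  rw [ht, inner_smul_left]

lemma inner_waveBilinear_waveBilinear (e : K ≃ₗᵢ[ℂ] L2R) (x x' : K) (χ χ' : E) :
    (inner ℂ (waveBilinear e x χ) (waveBilinear e x' χ') : ℂ) = inner ℂ x x' * inner ℂ χ χ' := by
  rw [inner_waveBilinear, ← e.inner_map_map, L2.inner_def, ← integral_mul_const]
  refine integral_congr_ae ?_
  filter_upwards [coeFn_waveBilinear e x' χ'] with t ht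
  rw [ht, inner_smul_right, RCLike.inner_apply]
  ring

/-- The isometry of the algebraic tensor product `K ⊗ E` into `L²(ℝ; E)`. -/
def waveIsometryAlg (e : K ≃ₗᵢ[ℂ] L2R) : K ⊗[ℂ] E →ₗᵢ[ℂ] L2 E :=
  (TensorProduct.lift (waveBilinear e)).isometryOfInner fun z w => by
    induction z using TensorProduct.induction_on with
    | zero => simp
    | add a b ha hb => rw [map_add, inner_add_left, inner_add_left, ha, hb]
    | tmul x χ =>
      induction w using TensorProduct.induction_on with
      | zero => simp
      | add a b ha hb => rw [map_add, inner_add_right, inner_add_right, ha, hb]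
      | tmul x' χ' =>
        rw [TensorProduct.lift.tmul, TensorProduct.lift.tmul, TensorProduct.inner_tmul,
          inner_waveBilinear_waveBilinear]

variable [CompleteSpace E]

/-- The isometry of `K ⊗ E` into `L²(ℝ; E)`. -/
def waveIsometry (e : K ≃ₗᵢ[ℂ] L2R) : HilbertTensor K E →ₗᵢ[ℂ] L2 E where
  toLinearMap := ((waveIsometryAlg e).toContinuousLinearMap.extend
    (UniformSpace.Completion.toComplL (𝕜 := ℂ) (E := K ⊗[ℂ] E))).toLinearMap
  norm_map' z := by
    refine UniformSpace.Completion.induction_on z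
      (isClosed_eq (ContinuousLinearMap.continuous _).norm continuous_norm) fun a => ?_
    have h := (waveIsometryAlg (E := E) e).toContinuousLinearMap.extend_eq
      (e := UniformSpace.Completion.toComplL (𝕜 := ℂ) (E := K ⊗[ℂ] E))
      UniformSpace.Completion.denseRange_coe
      (UniformSpace.Completion.isUniformInducing_coe _) a
    rw [UniformSpace.Completion.norm_coe, ← (waveIsometryAlg (E := E) e).norm_map a]
    exact congrArg norm h

lemma waveIsometry_pureTensor (e : K ≃ₗᵢ[ℂ] L2R) (x : K) (χ : E) :
    waveIsometry e (pureTensor x χ) = waveBilinear e x χ :=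
  (waveIsometryAlg (E := E) e).toContinuousLinearMap.extend_eq
    (e := UniformSpace.Completion.toComplL (𝕜 := ℂ) (E := K ⊗[ℂ] E))
    UniformSpace.Completion.denseRange_coe
    (UniformSpace.Completion.isUniformInducing_coe _) (x ⊗ₜ[ℂ] χ)

/-- The range of an isometry of a complete space is closed, and here it contains every indicator
function times a vector; sums of these are dense. -/
lemma surjective_waveIsometry (e : K ≃ₗᵢ[ℂ] L2R) :
    Function.Surjective (waveIsometry (E := E) e) := by
  intro F
  have hcl : IsClosed (Set.range (waveIsometry (E := E) e)) :=
    (waveIsometry (E := E) e).isometry.isClosedEmbedding.isClosed_range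
  refine Lp.induction (by norm_num) (fun F => F ∈ Set.range (waveIsometry (E := E) e)) ?_ ?_ hcl F
  · intro χ s hs hμs
    refine ⟨pureTensor (e.symm (indicatorConstLp 2 hs hμs.ne (1 : ℂ))) χ, ?_⟩
    rw [waveIsometry_pureTensor]
    refine Lp.ext ?_
    rw [Lp.simpleFunc.coe_indicatorConst]
    filter_upwards [coeFn_waveBilinear e (e.symm (indicatorConstLp 2 hs hμs.ne (1 : ℂ))) χ,
      indicatorConstLp_coeFn (p := 2) (hs := hs) (hμs := hμs.ne) (c := (1 : ℂ)),
      indicatorConstLp_coeFn (p := 2) (hs := hs) (hμs := hμs.ne) (c := χ)] with t h1 h2 h3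
    rw [h1, e.apply_symm_apply, h2, h3]
    by_cases ht : t ∈ s <;> simp [ht]
  · rintro f g hf hg _ ⟨a, ha⟩ ⟨b, hb⟩
    exact ⟨a + b, by rw [map_add, ha, hb]⟩

/-- The unitary identification `K ⊗ E ≅ L²(ℝ; E)`. -/
def waveUnitary (e : K ≃ₗᵢ[ℂ] L2R) : HilbertTensor K E ≃ₗᵢ[ℂ] L2 E :=
  LinearIsometryEquiv.ofSurjective (waveIsometry e) (surjective_waveIsometry e)

lemma waveUnitary_pureTensor (e : K ≃ₗᵢ[ℂ] L2R) (x : K) (χ : E) :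
    waveUnitary e (pureTensor x χ) = waveBilinear e x χ :=
  waveIsometry_pureTensor e x χ

/-- A vector is determined by its inner products with elementary tensors, so the weak definition of
a wave function agrees with the unitary identification. -/
lemma isWaveFunction_iff (P : PWSystem K E) {x : HilbertTensor K E} {F : ℝ → E}
    (hF : MemLp F 2 (volume : Measure ℝ)) :
    P.IsWaveFunction x F ↔ waveUnitary P.timeRep x = hF.toLp := by
  have key : ∀ (f : K) (χ : E), (inner ℂ (waveBilinear P.timeRep f χ) hF.toLp : ℂ) =
      ∫ t, conj ((P.timeRep f : ℝ → ℂ) t) * inner ℂ χ (F t) := by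
    intro f χ
    rw [inner_waveBilinear]
    refine integral_congr_ae ?_
    filter_upwards [hF.coeFn_toLp] with t ht
    rw [ht]
  constructor
  · intro h
    rw [← LinearIsometryEquiv.eq_symm_apply]
    refine ext_inner_left ℂ fun z => ?_
    refine hilbertTensor_induction (p := fun z => (inner ℂ z x : ℂ) =
      inner ℂ z ((waveUnitary P.timeRep).symm hF.toLp))
      (isClosed_eq (by fun_prop) (by fun_prop)) (by simp) ?_ ?_ z
    · intro f χ
      have h' := (waveUnitary (E := E) P.timeRep).inner_map_map (pureTensor f χ)
        ((waveUnitary P.timeRep).symm hF.toLp)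
      rw [waveUnitary_pureTensor, LinearIsometryEquiv.apply_symm_apply] at h'
      rw [h f χ, ← key, h']
    · intro z w hz hw
      rw [inner_add_left, inner_add_left, hz, hw]
  · intro h f χ
    rw [← key, ← h, ← waveUnitary_pureTensor, LinearIsometryEquiv.inner_map_map]

end Wave

/-! ### Unitary operators between spaces of equal dimension -/

section Unitaries

variable {E : Type v} {E' : Type v'}
  [NormedAddCommGroup E] [InnerProductSpace ℂ E] [CompleteSpace E]
  [NormedAddCommGroup E'] [InnerProductSpace ℂ E'] [CompleteSpace E']

/-- Cardinals are well-ordered, so the infimum defining the dimension is attained. -/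
lemma exists_hilbertBasis_card_eq (E : Type v) [NormedAddCommGroup E] [InnerProductSpace ℂ E]
    [CompleteSpace E] :
    ∃ ι : Type v, Nonempty (HilbertBasis ι ℂ E) ∧ Cardinal.mk ι = hilbertDim E := by
  obtain ⟨w, b, -⟩ := exists_hilbertBasis ℂ E
  exact csInf_mem (s := {c | ∃ ι : Type v, Nonempty (HilbertBasis ι ℂ E) ∧ Cardinal.mk ι = c})
    ⟨_, w, ⟨b⟩, rfl⟩

lemma nonempty_unitary_of_hilbertDim_eq
    (h : Cardinal.lift.{v'} (hilbertDim E) = Cardinal.lift.{v} (hilbertDim E')) :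
    Nonempty (E ≃ₗᵢ[ℂ] E') := by
  obtain ⟨ι, ⟨b⟩, hι⟩ := exists_hilbertBasis_card_eq E
  obtain ⟨ι', ⟨b'⟩, hι'⟩ := exists_hilbertBasis_card_eq E'
  rw [← hι, ← hι'] at h
  obtain ⟨e⟩ := Cardinal.lift_mk_eq'.1 h
  have hr : Set.range (b ∘ e.symm) = Set.range b := e.symm.surjective.range_comp b
  let b₁ : HilbertBasis ι' ℂ E := HilbertBasis.mk (b.orthonormal.comp e.symm e.symm.injective)
    (by rw [hr, b.dense_span])
  exact ⟨b₁.repr.trans b'.repr.symm⟩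

-- Under these hypotheses x + y is orthogonal to x − y, so the reflection fixes the sum and negates
-- the difference.
omit [CompleteSpace E] in
lemma reflection_eq_of_inner_eq {x y : E} (hn : ‖x‖ = ‖y‖)
    (hi : (inner ℂ x y : ℂ) = inner ℂ y x) :
    (Submodule.span ℂ {x - y})ᗮ.reflection x = y := by
  have h1 : (Submodule.span ℂ {x - y})ᗮ.reflection (x + y) = x + y := by
    refine Submodule.reflection_mem_subspace_eq_self ?_
    rw [Submodule.mem_orthogonal_singleton_iff_inner_right, inner_sub_left, inner_add_right,
      inner_add_right, inner_self_eq_norm_sq_to_K, inner_self_eq_norm_sq_to_K, hn, hi]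
    ring
  have h2 := Submodule.reflection_orthogonalComplement_singleton_eq_neg (𝕜 := ℂ) (x - y)
  rw [map_add] at h1
  rw [map_sub] at h2
  have h3 : (2 : ℂ) • (Submodule.span ℂ {x - y})ᗮ.reflection x = (2 : ℂ) • y := by
    rw [two_smul, two_smul]
    linear_combination (norm := module) h1 + h2
  exact smul_right_injective E two_ne_zero h3

/-- Multiplication by a complex number of modulus one. -/
def phase (E : Type v) [NormedAddCommGroup E] [InnerProductSpace ℂ E] {z : ℂ} (hz : ‖z‖ = 1) :
    E ≃ₗᵢ[ℂ] E where
  toLinearEquiv := LinearEquiv.smulOfNeZero ℂ E z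
    (norm_ne_zero_iff.1 (by rw [hz]; exact one_ne_zero))
  norm_map' x := by
    change ‖z • x‖ = ‖x‖
    rw [norm_smul, hz, one_mul]

-- A phase z makes ⟪x, z y⟫ real, a reflection then takes x to z y, and the phase is undone. If the
-- inner product vanishes, z = 1 serves.
omit [CompleteSpace E] in
lemma exists_unitary_apply_eq {x y : E} (hn : ‖x‖ = ‖y‖) : ∃ R : E ≃ₗᵢ[ℂ] E, R x = y := by
  obtain ⟨z, hz, hzi⟩ : ∃ z : ℂ, ‖z‖ = 1 ∧ z * inner ℂ x y = ‖(inner ℂ x y : ℂ)‖ := by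
    by_cases h : (inner ℂ x y : ℂ) = 0
    · exact ⟨1, by simp, by simp [h]⟩
    · have h' : (‖(inner ℂ x y : ℂ)‖ : ℂ) ≠ 0 := by simpa using h
      refine ⟨conj (inner ℂ x y : ℂ) / ‖(inner ℂ x y : ℂ)‖, ?_, ?_⟩
      · rw [norm_div, RCLike.norm_conj, Complex.norm_real, norm_norm]
        exact div_self (norm_ne_zero_iff.2 h)
      · rw [div_mul_eq_mul_div, Complex.conj_mul', pow_two, mul_div_cancel_right₀ _ h']
  refine ⟨((Submodule.span ℂ {x - z • y})ᗮ.reflection).trans (phase E hz).symm, ?_⟩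
  rw [LinearIsometryEquiv.trans_apply, LinearIsometryEquiv.symm_apply_eq]
  refine reflection_eq_of_inner_eq (by rw [norm_smul, hz, one_mul, hn]) ?_
  rw [← inner_conj_symm (z • y) x, inner_smul_right, hzi, Complex.conj_ofReal]

end Unitaries

/-! ### Conjugation of operators and groups -/

section Conjugation

open Filter Topology

variable {X : Type u} {Y : Type v}
  [NormedAddCommGroup X] [InnerProductSpace ℂ X]
  [NormedAddCommGroup Y] [InnerProductSpace ℂ Y]

lemma mem_graph_unitaryConj (S : X ≃ₗᵢ[ℂ] Y) (A : X →ₗ.[ℂ] X) {x y : Y} :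
    (x, y) ∈ (unitaryConj S A).graph ↔ (S.symm x, S.symm y) ∈ A.graph := by
  simp only [LinearPMap.mem_graph_iff]
  constructor
  · rintro ⟨a, rfl, rfl⟩
    exact ⟨⟨S.symm a, a.2⟩, rfl, (S.symm_apply_apply _).symm⟩
  · rintro ⟨a, ha, hy⟩
    have hx : x ∈ (unitaryConj S A).domain := by
      change S.symm x ∈ A.domain
      rw [← ha]
      exact a.2
    refine ⟨⟨x, hx⟩, rfl, ?_⟩
    have hax : a = ⟨S.symm x, hx⟩ := Subtype.ext ha
    change S (A ⟨S.symm x, hx⟩) = y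
    rw [← hax, hy, S.apply_symm_apply]

lemma hasDerivAt_unitary_comp_iff (S : X ≃ₗᵢ[ℂ] Y) {f : ℝ → X} {z : X} {t : ℝ} :
    HasDerivAt (fun t => S (f t)) (S z) t ↔ HasDerivAt f z t := by
  constructor
  · intro h
    have h' := ((S.symm.toContinuousLinearEquiv : Y →L[ℂ] X).hasFDerivAt.restrictScalars ℝ)
      |>.comp_hasDerivAt t h
    refine (h'.congr_of_eventuallyEq (Eventually.of_forall fun s => ?_)).congr_deriv ?_
    · exact (S.symm_apply_apply _).symm
    · exact S.symm_apply_apply _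
  · intro h
    exact ((S.toContinuousLinearEquiv : X →L[ℂ] Y).hasFDerivAt.restrictScalars ℝ)
      |>.comp_hasDerivAt t h

/-- The group `s ↦ S⁻¹ U(s) S`. -/
def conjGroup (S : X ≃ₗᵢ[ℂ] Y) (U : ℝ → (Y ≃ₗᵢ[ℂ] Y)) (s : ℝ) : X ≃ₗᵢ[ℂ] X :=
  (S.trans (U s)).trans S.symm

lemma conjGroup_apply (S : X ≃ₗᵢ[ℂ] Y) (U : ℝ → (Y ≃ₗᵢ[ℂ] Y)) (s : ℝ) (x : X) :
    conjGroup S U s x = S.symm (U s (S x)) := rfl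

lemma IsUnitaryGroup.conj {U : ℝ → (Y ≃ₗᵢ[ℂ] Y)} (hU : IsUnitaryGroup U) (S : X ≃ₗᵢ[ℂ] Y) :
    IsUnitaryGroup (conjGroup S U) where
  add s t x := by simp only [conjGroup_apply, hU.add, LinearIsometryEquiv.apply_symm_apply]
  continuous x := S.symm.continuous.comp (hU.continuous (S x))

end Conjugation

namespace PWSystem

open Filter Topology

variable {K : Type u} {E : Type v}
  [NormedAddCommGroup K] [InnerProductSpace ℂ K]
  [NormedAddCommGroup E] [InnerProductSpace ℂ E] [CompleteSpace E]

/-! ### The clock -/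

lemma mem_graph_clockHamiltonian_iff (P : PWSystem K E) (ħ : ℝ) {x y : K} :
    (x, y) ∈ (P.clockHamiltonian ħ).graph ↔ ∃ g : L2R, (P.timeRep x, g) ∈ weakDerivGraph ∧
      P.timeRep y = (-(Complex.I * (ħ : ℂ))) • g := by
  have hg : timeDeriv.graph = weakDerivGraph :=
    Submodule.toLinearPMap_graph_eq weakDerivGraph weakDerivGraph_single_valued
  rw [clockHamiltonian, mem_graph_unitaryConj, LinearIsometryEquiv.symm_symm, ← hg]
  simp only [LinearPMap.mem_graph_iff]
  constructor
  · rintro ⟨a, ha, hy⟩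
    exact ⟨timeDeriv a, ⟨a, ha, rfl⟩, hy.symm⟩
  · rintro ⟨g, ⟨a, ha, rfl⟩, hy⟩
    exact ⟨a, ha, hy.symm⟩

/-- The group of time translations of the clock. -/
def clockGroup (P : PWSystem K E) : ℝ → (K ≃ₗᵢ[ℂ] K) := conjGroup P.timeRep (translation ℂ)

lemma isUnitaryGroup_clockGroup (P : PWSystem K E) : IsUnitaryGroup P.clockGroup :=
  isUnitaryGroup_translation.conj P.timeRep

/-- The translates f(· − t) have derivative −f', and −(i/ħ)(−iħ) = −1, so the signs match. -/
lemma hasDerivAt_clockGroup (P : PWSystem K E) {ħ : ℝ} (hħ : ħ ≠ 0) {x y : K}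
    (h : (x, y) ∈ (P.clockHamiltonian ħ).graph) :
    HasDerivAt (fun t => P.clockGroup t x) (-(Complex.I / (ħ : ℂ)) • y) 0 := by
  obtain ⟨g, hg, hy⟩ := (P.mem_graph_clockHamiltonian_iff ħ).1 h
  rw [← hasDerivAt_unitary_comp_iff P.timeRep]
  simp only [clockGroup, conjGroup_apply, LinearIsometryEquiv.apply_symm_apply]
  refine (hasDerivAt_translation hg).congr_deriv ?_
  have hħ' : (ħ : ℂ) ≠ 0 := Complex.ofReal_ne_zero.2 hħ
  have hc : -(Complex.I / (ħ : ℂ)) * (-(Complex.I * (ħ : ℂ))) = -1 := by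
    field_simp
    rw [Complex.I_sq]
  rw [map_smul, hy, smul_smul, hc, neg_one_smul]

lemma clockGroup_mem_graph (P : PWSystem K E) (ħ : ℝ) {x y : K}
    (h : (x, y) ∈ (P.clockHamiltonian ħ).graph) (s : ℝ) :
    (P.clockGroup s x, P.clockGroup s y) ∈ (P.clockHamiltonian ħ).graph := by
  obtain ⟨g, hg, hy⟩ := (P.mem_graph_clockHamiltonian_iff ħ).1 h
  refine (P.mem_graph_clockHamiltonian_iff ħ).2 ⟨translation ℂ s g, ?_, ?_⟩
  · simp only [clockGroup, conjGroup_apply, LinearIsometryEquiv.apply_symm_apply]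
    exact translation_mem_weakDerivGraph hg s
  · simp only [clockGroup, conjGroup_apply, LinearIsometryEquiv.apply_symm_apply]
    rw [hy, map_smul]

lemma dense_domain_clockHamiltonian (P : PWSystem K E) (ħ : ℝ) :
    Dense ((P.clockHamiltonian ħ).domain : Set K) := by
  have h := P.timeRep.symm.surjective.denseRange.dense_image P.timeRep.symm.continuous
    dense_image_fst_weakDerivGraph
  refine h.mono ?_
  rintro _ ⟨_, ⟨⟨f, g⟩, hfg, rfl⟩, rfl⟩
  refine LinearPMap.mem_domain_of_mem_graph (y := P.timeRep.symm ((-(Complex.I * (ħ : ℂ))) • g))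
    ((P.mem_graph_clockHamiltonian_iff ħ).2 ⟨g, ?_, ?_⟩)
  · simpa using hfg
  · simp

/-! ### The total evolution -/

/-- The group `(G(s) F)(t) = U(s) F(t - s)` in the wave representation. -/
def totalGroup (P : PWSystem K E) (U : ℝ → (E ≃ₗᵢ[ℂ] E)) :
    ℝ → (HilbertTensor K E ≃ₗᵢ[ℂ] HilbertTensor K E) :=
  conjGroup (waveUnitary P.timeRep) fun s => (translation E s).trans
    (mulUnitary (fun _ => U s) ((U s).continuous.comp continuous_snd)
      ((U s).symm.continuous.comp continuous_snd))

lemma coeFn_totalGroup (P : PWSystem K E) (U : ℝ → (E ≃ₗᵢ[ℂ] E)) (s : ℝ)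
    (x : HilbertTensor K E) :
    waveUnitary P.timeRep (P.totalGroup U s x) =ᵐ[volume]
      fun t => U s (waveUnitary P.timeRep x (t - s)) := by
  rw [totalGroup, conjGroup_apply, LinearIsometryEquiv.apply_symm_apply]
  refine (coeFn_mulUnitary (fun _ => U s) ((U s).continuous.comp continuous_snd)
    ((U s).symm.continuous.comp continuous_snd) _).trans ?_
  filter_upwards [coeFn_translation s (waveUnitary P.timeRep x)] with t ht
  exact congrArg (U s) ht

/-- This exhibits G(s) as the clock translation tensored with U(s), the form required by
`mem_tensorSumGraph_iff`. -/
lemma totalGroup_pureTensor (P : PWSystem K E) (U : ℝ → (E ≃ₗᵢ[ℂ] E))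
    (s : ℝ) (x : K) (χ : E) :
    P.totalGroup U s (pureTensor x χ) = pureTensor (P.clockGroup s x) (U s χ) := by
  apply (waveUnitary (E := E) P.timeRep).injective
  refine Lp.ext ((P.coeFn_totalGroup U s _).trans ?_)
  rw [waveUnitary_pureTensor, waveUnitary_pureTensor]
  filter_upwards [ae_sub_right (coeFn_waveBilinear P.timeRep x χ) s,
    coeFn_waveBilinear P.timeRep (P.clockGroup s x) (U s χ),
    coeFn_translation s (P.timeRep x)] with t h1 h2 h3
  rw [h1, h2, map_smul, clockGroup, conjGroup_apply, LinearIsometryEquiv.apply_symm_apply, h3]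

lemma isUnitaryGroup_totalGroup (P : PWSystem K E) {U : ℝ → (E ≃ₗᵢ[ℂ] E)}
    (hU : IsUnitaryGroup U) : IsUnitaryGroup (P.totalGroup U) where
  add s t z := by
    refine hilbertTensor_induction
      (p := fun z => P.totalGroup U (s + t) z = P.totalGroup U s (P.totalGroup U t z))
      (isClosed_eq (LinearIsometryEquiv.continuous _)
        ((LinearIsometryEquiv.continuous _).comp (LinearIsometryEquiv.continuous _))) (by simp)
      (fun x χ => ?_) (fun z w hz hw => ?_) z
    · simp only [totalGroup_pureTensor, hU.add, P.isUnitaryGroup_clockGroup.add]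
    · simp only [map_add, hz, hw]
  continuous z := by
    refine hilbertTensor_induction (p := fun z => Continuous fun t => P.totalGroup U t z)
      isClosed_setOf_continuous_orbit (by simpa using continuous_const) (fun x χ => ?_)
      (fun z w hz hw => ?_) z
    · simp only [totalGroup_pureTensor]
      exact ((UniformSpace.Completion.continuous_coe _).comp TensorProduct.continuous_tmul).comp
        ((P.isUnitaryGroup_clockGroup.continuous x).prodMk (hU.continuous χ))
    · simp only [map_add]
      exact hz.add hw

/-- With the closed Hamiltonian identified as the full generator of G, conjugating Hamiltonians with
their exact domains amounts to intertwining groups. Invariance of the domain of H_r holds because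
U(s) commutes with the group it belongs to. -/
lemma mem_graph_hamiltonian_iff (P : PWSystem K E) {ħ : ℝ} (hħ : ħ ≠ 0)
    {U : ℝ → (E ≃ₗᵢ[ℂ] E)} (hU : IsEvolutionGroup ħ P.worldHamiltonian U)
    {x y : HilbertTensor K E} :
    (x, y) ∈ (P.hamiltonian ħ).graph ↔
      HasDerivAt (fun t => P.totalGroup U t x) (-(Complex.I / (ħ : ℂ)) • y) 0 := by
  rw [hamiltonian_graph]
  refine mem_tensorSumGraph_iff (by simp [hħ]) P.isUnitaryGroup_clockGroup hU.isUnitaryGroup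
    (P.isUnitaryGroup_totalGroup hU.isUnitaryGroup) (P.totalGroup_pureTensor _)
    (P.dense_domain_clockHamiltonian ħ)
    P.selfAdjoint.dense_domain (fun _ _ => P.hasDerivAt_clockGroup hħ)
    (fun x y => (hU.generator x y).1) (fun _ _ => P.clockGroup_mem_graph ħ) ?_
  intro x y h s
  refine (hU.generator _ _).2 ?_
  rw [← map_smul]
  exact hU.isUnitaryGroup.hasDerivAt_apply ((hU.generator x y).1 h) s

/-! ### Multiplication operators between Page-Wootters systems -/

variable {K' : Type u'} {E' : Type v'}
  [NormedAddCommGroup K'] [InnerProductSpace ℂ K']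
  [NormedAddCommGroup E'] [InnerProductSpace ℂ E'] [CompleteSpace E']

/-- The unitary operator `F ↦ (t ↦ W(t) F(t))` in the wave representations. -/
def waveMul (P : PWSystem K E) (P' : PWSystem K' E') (W : ℝ → E ≃ₗᵢ[ℂ] E')
    (hW : Continuous fun p : ℝ × E => W p.1 p.2)
    (hW' : Continuous fun p : ℝ × E' => (W p.1).symm p.2) :
    HilbertTensor K E ≃ₗᵢ[ℂ] HilbertTensor K' E' :=
  ((waveUnitary P.timeRep).trans (mulUnitary W hW hW')).trans (waveUnitary P'.timeRep).symm

section WaveMul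

variable (P : PWSystem K E) (P' : PWSystem K' E') {W : ℝ → E ≃ₗᵢ[ℂ] E'}
  (hW : Continuous fun p : ℝ × E => W p.1 p.2)
  (hW' : Continuous fun p : ℝ × E' => (W p.1).symm p.2)

lemma coeFn_waveMul (x : HilbertTensor K E) :
    waveUnitary P'.timeRep (waveMul P P' W hW hW' x) =ᵐ[volume]
      fun t => W t (waveUnitary P.timeRep x t) := by
  rw [waveMul, LinearIsometryEquiv.trans_apply, LinearIsometryEquiv.apply_symm_apply]
  exact coeFn_mulUnitary W hW hW' _

omit [CompleteSpace E] [CompleteSpace E'] in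
lemma hasCompactSupport_unitary_apply {F : ℝ → E} (hF : HasCompactSupport F) :
    HasCompactSupport fun t => W t (F t) :=
  hF.mono fun t ht h => ht (by simp only [h, map_zero])

lemma isWaveFunction_waveMul {x : HilbertTensor K E} {F : ℝ → E} (hF : Continuous F)
    (hc : HasCompactSupport F) (hx : P.IsWaveFunction x F) :
    P'.IsWaveFunction (waveMul P P' W hW hW' x) fun t => W t (F t) := by
  have hm := hF.memLp_of_hasCompactSupport (p := 2) (μ := (volume : Measure ℝ)) hc
  have hm' := (hW.comp (continuous_id.prodMk hF)).memLp_of_hasCompactSupport (p := 2)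
    (μ := (volume : Measure ℝ)) (hasCompactSupport_unitary_apply hc)
  rw [isWaveFunction_iff P hm] at hx
  refine (isWaveFunction_iff P' hm').2 (Lp.ext ((coeFn_waveMul P P' hW hW' x).trans ?_))
  filter_upwards [hm.coeFn_toLp, hm'.coeFn_toLp] with t h1 h2
  rw [h2, hx, h1]
  rfl

lemma isWaveFunction_of_waveMul {x : HilbertTensor K E} {F : ℝ → E'} (hF : Continuous F)
    (hc : HasCompactSupport F) (hx : P'.IsWaveFunction (waveMul P P' W hW hW' x) F) :
    P.IsWaveFunction x fun t => (W t).symm (F t) := by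
  have hm := hF.memLp_of_hasCompactSupport (p := 2) (μ := (volume : Measure ℝ)) hc
  have hm' := (hW'.comp (continuous_id.prodMk hF)).memLp_of_hasCompactSupport (p := 2)
    (μ := (volume : Measure ℝ)) (hasCompactSupport_unitary_apply (W := fun t => (W t).symm) hc)
  rw [isWaveFunction_iff P' hm] at hx
  refine (isWaveFunction_iff P hm').2 (Lp.ext ?_)
  have h0 := coeFn_waveMul P P' hW hW' x
  rw [hx] at h0
  filter_upwards [h0, hm.coeFn_toLp, hm'.coeFn_toLp] with t h1 h2 h3
  rw [h3]
  change _ = (W t).symm (F t)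
  rw [← h2, h1, LinearIsometryEquiv.symm_apply_apply]

lemma mem_testSpace_iff_waveMul (x : HilbertTensor K E) :
    x ∈ P.testSpace ↔ waveMul P P' W hW hW' x ∈ P'.testSpace := by
  constructor
  · rintro ⟨F, hF, hc, hx⟩
    exact ⟨_, hW.comp (continuous_id.prodMk hF), hasCompactSupport_unitary_apply hc,
      isWaveFunction_waveMul P P' hW hW' hF hc hx⟩
  · rintro ⟨F, hF, hc, hx⟩
    exact ⟨_, hW'.comp (continuous_id.prodMk hF),
      hasCompactSupport_unitary_apply (W := fun t => (W t).symm) hc,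
      isWaveFunction_of_waveMul P P' hW hW' hF hc hx⟩

/-- Continuous wave functions are unique, so the relation holds at every t and not just almost
everywhere, as evaluation at a clock reading requires. -/
lemma waveFunction_waveMul (x : P.testSpace) (y : P'.testSpace)
    (hxy : (y : HilbertTensor K' E') = waveMul P P' W hW hW' x) (t : ℝ) :
    P'.waveFunction y t = W t (P.waveFunction x t) := by
  have h := isWaveFunction_waveMul P P' hW hW' (P.continuous_waveFunction x)
    (P.hasCompactSupport_waveFunction x) (P.isWaveFunction_waveFunction x)
  rw [← hxy] at h
  exact congrFun (IsWaveFunction.unique (P'.continuous_waveFunction y)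
    (P'.hasCompactSupport_waveFunction y) (P'.isWaveFunction_waveFunction y)
    (hW.comp (continuous_id.prodMk (P.continuous_waveFunction x)))
    (hasCompactSupport_unitary_apply (P.hasCompactSupport_waveFunction x)) h) t

/-- Evaluated at t, both sides act on F(t − s), and `hWU` equates the two operators applied to it.
-/
lemma waveMul_totalGroup {U : ℝ → (E ≃ₗᵢ[ℂ] E)} {U' : ℝ → (E' ≃ₗᵢ[ℂ] E')}
    (hWU : ∀ s t x, W t (U s x) = U' s (W (t - s) x)) (s : ℝ) (x : HilbertTensor K E) :
    waveMul P P' W hW hW' (P.totalGroup U s x) =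
      P'.totalGroup U' s (waveMul P P' W hW hW' x) := by
  apply (waveUnitary (E := E') P'.timeRep).injective
  refine Lp.ext ((coeFn_waveMul P P' hW hW' _).trans
    (EventuallyEq.trans ?_ (P'.coeFn_totalGroup U' s _).symm))
  filter_upwards [P.coeFn_totalGroup U s x,
    ae_sub_right (coeFn_waveMul P P' hW hW' x) s] with t h1 h2
  rw [h1, h2, hWU]

end WaveMul

/-! ### The intertwining family between two worlds -/

/-- The family `t ↦ U'(t) V U(-t)`, which takes the world of one system to that of another. -/
def intertwiner (U : ℝ → (E ≃ₗᵢ[ℂ] E)) (U' : ℝ → (E' ≃ₗᵢ[ℂ] E')) (V : E ≃ₗᵢ[ℂ] E') (t : ℝ) :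
    E ≃ₗᵢ[ℂ] E' :=
  ((U (-t)).trans V).trans (U' t)

omit [CompleteSpace E] [CompleteSpace E'] in
lemma intertwiner_apply (U : ℝ → (E ≃ₗᵢ[ℂ] E)) (U' : ℝ → (E' ≃ₗᵢ[ℂ] E')) (V : E ≃ₗᵢ[ℂ] E')
    (t : ℝ) (x : E) : intertwiner U U' V t x = U' t (V (U (-t) x)) := rfl

section Intertwiner

variable {U : ℝ → (E ≃ₗᵢ[ℂ] E)} (hU : IsUnitaryGroup U) {U' : ℝ → (E' ≃ₗᵢ[ℂ] E')}
  (hU' : IsUnitaryGroup U') (V : E ≃ₗᵢ[ℂ] E')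

include hU hU'

omit [CompleteSpace E] [CompleteSpace E'] in
lemma continuous_intertwiner : Continuous fun p : ℝ × E => intertwiner U U' V p.1 p.2 :=
  hU'.continuous_uncurry.comp (continuous_fst.prodMk (V.continuous.comp
    (hU.continuous_uncurry.comp (continuous_fst.neg.prodMk continuous_snd))))

omit [CompleteSpace E] [CompleteSpace E'] in
lemma continuous_intertwiner_symm :
    Continuous fun p : ℝ × E' => (intertwiner U U' V p.1).symm p.2 := by
  have h : ∀ p : ℝ × E', (intertwiner U U' V p.1).symm p.2 =
      U p.1 (V.symm (U' (-p.1) p.2)) := by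
    intro p
    rw [LinearIsometryEquiv.symm_apply_eq, intertwiner_apply, hU.neg_apply_apply,
      V.apply_symm_apply, hU'.apply_neg_apply]
  simp only [h]
  exact hU.continuous_uncurry.comp (continuous_fst.prodMk (V.symm.continuous.comp
    (hU'.continuous_uncurry.comp (continuous_fst.neg.prodMk continuous_snd))))

-- U(−t)U(s) = U(−(t − s)) and U'(t) = U'(s)U'(t − s); V is arbitrary, and the two Hamiltonians need
-- not be related.
omit [CompleteSpace E] [CompleteSpace E'] in
lemma intertwiner_comp (s t : ℝ) (x : E) :
    intertwiner U U' V t (U s x) = U' s (intertwiner U U' V (t - s) x) := by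
  rw [intertwiner_apply, intertwiner_apply, ← hU.add, ← hU'.add]
  congr 2
  · ring
  · congr 2
    ring

end Intertwiner

end PWSystem

end PageWootters

end

/-! ### Maximal ambiguity -/

theorem mainTheorem1
    {K : Type u} {E : Type v} {K' : Type u'} {E' : Type v'}
    [NormedAddCommGroup K] [InnerProductSpace ℂ K]
    [NormedAddCommGroup E] [InnerProductSpace ℂ E] [CompleteSpace E]
    [NormedAddCommGroup K'] [InnerProductSpace ℂ K']
    [NormedAddCommGroup E'] [InnerProductSpace ℂ E'] [CompleteSpace E']
    (ħ : ℝ) (hħ : 0 < ħ)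
    (P : PageWootters.PWSystem K E) (P' : PageWootters.PWSystem K' E')
    (hdim : Cardinal.lift.{v'} (PageWootters.hilbertDim E) =
      Cardinal.lift.{v} (PageWootters.hilbertDim E'))
    (ψ₀ : E) (ψ₀' : E') (hψ : ‖ψ₀‖ = ‖ψ₀'‖) :
    ∃ S : PageWootters.HilbertTensor K E ≃ₗᵢ[ℂ] PageWootters.HilbertTensor K' E',
      P'.hamiltonian ħ = PageWootters.unitaryConj S (P.hamiltonian ħ) ∧
      ∃ hS : ∀ x, x ∈ P.testSpace ↔ S x ∈ P'.testSpace,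
        ∀ τ : ℝ, P'.temporalState ħ ψ₀' τ =
          PageWootters.PWSystem.mapGeneralized S hS (P.temporalState ħ ψ₀ τ) := by
  open PageWootters PageWootters.PWSystem in
  obtain ⟨V₀⟩ := nonempty_unitary_of_hilbertDim_eq hdim
  -- `R` corrects the arbitrary unitary `V₀` so that the initial states correspond; this is where
  -- equality of norms enters.
  obtain ⟨R, hR⟩ := exists_unitary_apply_eq (x := V₀ ψ₀) (y := ψ₀') (by rw [V₀.norm_map, hψ])
  let V : E ≃ₗᵢ[ℂ] E' := V₀.trans R
  have hV : V ψ₀ = ψ₀' := hR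
  have hU := isEvolutionGroup_evolution hħ.ne' P.selfAdjoint
  have hU' := isEvolutionGroup_evolution hħ.ne' P'.selfAdjoint
  have hW := continuous_intertwiner hU.isUnitaryGroup hU'.isUnitaryGroup V
  have hW' := continuous_intertwiner_symm hU.isUnitaryGroup hU'.isUnitaryGroup V
  have hSG := waveMul_totalGroup P P' hW hW'
    (intertwiner_comp hU.isUnitaryGroup hU'.isUnitaryGroup V)
  refine ⟨waveMul P P' _ hW hW', ?_, mem_testSpace_iff_waveMul P P' hW hW', fun τ => ?_⟩
  -- Comparing graphs settles domains and values at once: both graphs are derivative conditions, and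
  -- S carries one group to the other.
  · refine LinearPMap.eq_of_eq_graph (Submodule.ext ?_)
    rintro ⟨x, y⟩
    rw [mem_graph_unitaryConj, mem_graph_hamiltonian_iff P hħ.ne' hU,
      mem_graph_hamiltonian_iff P' hħ.ne' hU',
      ← hasDerivAt_unitary_comp_iff (waveMul P P' _ hW hW')]
    simp only [hSG, map_smul, LinearIsometryEquiv.apply_symm_apply]
  · refine LinearMap.ext fun y => ?_
    have hy := waveFunction_waveMul P P' hW hW'
      ⟨_, (mem_testSpace_iff_waveMul P P' hW hW' ((waveMul P P' _ hW hW').symm y)).2 (by simp)⟩ y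
      (by simp) τ
    change (inner ℂ (P'.waveFunction y τ) (P'.history ħ ψ₀' τ) : ℂ) =
      inner ℂ (P.waveFunction ⟨(waveMul P P' _ hW hW').symm y, _⟩ τ) (P.history ħ ψ₀ τ)
    -- The factor U(−τ) returns the state to ψ(0), V sends it to ψ'(0), and U'(τ) evolves it.
    have hψτ : P'.history ħ ψ₀' τ = intertwiner (evolution ħ P.worldHamiltonian)
        (evolution ħ P'.worldHamiltonian) V τ (P.history ħ ψ₀ τ) := by
      rw [intertwiner_apply, history, history, hU.isUnitaryGroup.neg_apply_apply, hV]
    rw [hy, hψτ, LinearIsometryEquiv.inner_map_map]
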